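/- Let $q\ge 3$ be a prime power, $n=q^4-1$ and $2\le a\le q^2-1$. Then there is an entanglement-assisted quantum (QUENTA) code with parameters $$[[\,n,\;n-4(a-1)-3,\;d\ge a+1;\;1\,]]_q .$$ Here an $[[n,k,d;c]]_q$ QUENTA code encodes $k$ logical qudits (of dimension $q$) into $n$ physical qudits by applying an isometry to the $k$ logical qudits and the sender's halves of $c$ maximally entangled pairs $q^{-1/2}\sum_s|s\rangle|s\rangle$, and $d\ge\delta$ means that every error acting on fewer than $\delta$ of the $n$ physical qudits (and not on the receiver's $c$ halves) is detectable, i.e. satisfies the Knill–Laflamme condition on the space of encoded states. Moreover, such a code can be obtained by the Hermitian construction from a cyclic code. Let $\alpha\in\mathbb{F}_{q^4}$ be a primitive $n$-th root of unity and let $\mathbb{C}_s=\{s q^{2j} \bmod n : j\ge 0\}$ denote the $q^2$-ary cyclotomic coset of $s$ modulo $n$. There is a cyclic code $C_a\subseteq\mathbb{F}_{q^2}^n$ with defining set (exponents $z$ modulo $n$ such that $\alpha^z$ is a root of every code polynomial) $$Z(C_a)=\mathbb{C}_0\cup\mathbb{C}_{q^2+1}\cup\bigcup_{i=2}^{a}\mathbb{C}_{q^2+i},$$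 such that, for any $\mathbb{F}_q$-basis of $\mathbb{F}_{q^2}$ (identifying $\mathbb{F}_{q^2}^n$ with $\mathbb{F}_q^{n}\times\mathbb{F}_q^{n}$) and any nontrivial additive character $\chi$ of $\mathbb{F}_q$, the QUENTA code above can be chosen so that for every $u$ in the Hermitian dual $C_a^{\perp_h}$, with coordinates $(x,z)\in\mathbb{F}_q^{n}\times\mathbb{F}_q^{n}$, the Weyl operator $X(x)Z(z):|y\rangle\mapsto\chi\big(\sum_i z_iy_i\big)|y+x\rangle$ on the $n$ physical qudits, tensored with a suitable unitary on the receiver's side, fixes every encoded state. -/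

import Mathlib

open scoped Matrix Kronecker

namespace QUENTA

/-! ### Entanglement-assisted quantum codes

The state space of one qudit is `ℂ^A`, with orthonormal basis labelled by the finite alphabet `A`
(`q = |A|`); the space of `n` qudits is `ℂ^(A^n)`.  Vectors are functions, operators are matrices. -/

section Quantum

variable {A : Type*} [Fintype A] [DecidableEq A]

/-- The Hermitian inner product `⟨u, v⟩ = ∑ x, conj (u x) * v x`. -/
def braket {X : Type*} [Fintype X] (u v : X → ℂ) : ℂ := ∑ x, star (u x) * v x

/-- `c` copies of the maximally entangled state `q^(-1/2) ∑ s, |s⟩ ⊗ |s⟩`; the first halves belong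
to the sender, the second halves to the receiver. -/
noncomputable def maxEntangled (A : Type*) [Fintype A] [DecidableEq A] (c : ℕ) :
    (Fin c → A) × (Fin c → A) → ℂ :=
  fun j => ∏ i, if j.1 i = j.2 i then ((Real.sqrt (Fintype.card A) : ℝ) : ℂ)⁻¹ else 0

/-- An entanglement-assisted quantum code that encodes `k` logical qudits into `n` physical qudits
using `c` maximally entangled pairs.  The sender applies to the `k` logical qudits and to the
sender's halves of the `c` pairs an isometry into `n` qudits (equivalently: adjoins `n - k - c`
ancilla qudits in a fixed state and applies a unitary on `n` qudits). -/
structure Code (A : Type*) [Fintype A] [DecidableEq A] (n k c : ℕ) where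
  encoder : Matrix (Fin n → A) ((Fin k → A) × (Fin c → A)) ℂ
  isometry : encoderᴴ * encoder = 1

variable {n k c : ℕ}

/-- The state, shared by the `n` transmitted qudits and the receiver's `c` halves, that encodes the
logical state `ψ`:  `(encoder ⊗ 1) (ψ ⊗ Φ)`. -/
noncomputable def Code.encode (Q : Code A n k c) (ψ : (Fin k → A) → ℂ) :
    (Fin n → A) × (Fin c → A) → ℂ :=
  (Q.encoder ⊗ₖ (1 : Matrix (Fin c → A) (Fin c → A) ℂ)) *ᵥ
    fun x => ψ x.1.1 * maxEntangled A c (x.1.2, x.2)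

/-- The operator `E` on `n` qudits acts only on the qudits in `T`: it is `M ⊗ 1`, with `M` an
operator on the qudits in `T` and `1` the identity on the other qudits. -/
def ActsOn (T : Finset (Fin n)) (E : Matrix (Fin n → A) (Fin n → A) ℂ) : Prop :=
  ∃ M : Matrix (T → A) (T → A) ℂ, ∀ x y : Fin n → A,
    ((∀ i, i ∉ T → x i = y i) → E x y = M (fun i => x i) (fun i => y i)) ∧
    (¬ (∀ i, i ∉ T → x i = y i) → E x y = 0)

/-- The minimum distance is at least `d`: every error that acts on fewer than `d` of the `n`
transmitted qudits (and not on the receiver's halves) is detectable, in the sense of the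
Knill-Laflamme conditions. -/
def Code.MinDistGE (Q : Code A n k c) (d : ℕ) : Prop :=
  ∀ (T : Finset (Fin n)) (E : Matrix (Fin n → A) (Fin n → A) ℂ), T.card < d → ActsOn T E →
    ∃ l : ℂ, ∀ φ ψ : (Fin k → A) → ℂ,
      braket (Q.encode φ) ((E ⊗ₖ (1 : Matrix (Fin c → A) (Fin c → A) ℂ)) *ᵥ Q.encode ψ) =
        l * braket (Q.encode φ) (Q.encode ψ)

end Quantum

/-! ### Cyclic codes -/

section Cyclic

variable {K L : Type*} [Field K] [Field L] [Algebra K L] {n : ℕ}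

/-- A linear code of length `n` is cyclic if it is invariant under the cyclic shift. -/
def IsCyclicCode (C : Submodule K (Fin n → K)) : Prop :=
  ∀ v ∈ C, (fun i => v (finRotate n i)) ∈ C

/-- The defining set, relative to the `n`-th root of unity `α`: all exponents `z` modulo `n` such
that `α ^ z` is a root of every code polynomial `∑ i, v i * X ^ i`. -/
def definingSet (α : L) (C : Submodule K (Fin n → K)) : Set ℕ :=
  {z | z < n ∧ ∀ v ∈ C, ∑ i : Fin n, algebraMap K L (v i) * (α ^ z) ^ (i : ℕ) = 0}

/-- The `Q`-ary cyclotomic coset of `s` modulo `n`. -/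
def cyclotomicCoset (Q n s : ℕ) : Set ℕ := {z | ∃ j : ℕ, z = s * Q ^ j % n}

/-- The Hermitian dual code (for `K` with `q ^ 2` elements). -/
def hermitianDual (q : ℕ) (C : Submodule K (Fin n → K)) : Submodule K (Fin n → K) where
  carrier := {u | ∀ v ∈ C, ∑ i, u i * v i ^ q = 0}
  zero_mem' := by intro v _; simp
  add_mem' := by
    intro u w hu hw v hv
    simp [add_mul, Finset.sum_add_distrib, hu v hv, hw v hv]
  smul_mem' := by
    intro r u hu v hv
    simp [mul_assoc, ← Finset.mul_sum, hu v hv]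

end Cyclic

/-! ### The Hermitian construction -/

section Hermitian

variable {F K : Type*} [Field F] [Fintype F] [DecidableEq F] [Field K] [Algebra F K] {n k c : ℕ}

/-- The Weyl (generalized Pauli) operator `X(a) Z(b)` on `n` qudits with alphabet `F`:
`|x⟩ ↦ χ (∑ i, b i * x i) |x + a⟩`. -/
def weyl (χ : AddChar F ℂ) (a b : Fin n → F) : Matrix (Fin n → F) (Fin n → F) ℂ :=
  fun y x => if y = x + a then χ (∑ i, b i * x i) else 0

/-- `Q` is a code given by the Hermitian construction from the linear code `C` over `K`, where
`K` has degree 2 over `F`: `K^n` is identified with `F^n × F^n` by means of the basis `β`, and each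
Weyl operator labelled by a vector of the Hermitian dual of `C` extends, by some unitary on the
receiver's halves, to an operator that fixes all encoded states. -/
def IsHermitianConstruction (β : Module.Basis (Fin 2) F K) (χ : AddChar F ℂ)
    (C : Submodule K (Fin n → K)) (Q : Code F n k c) : Prop :=
  ∀ u ∈ hermitianDual (Fintype.card F) C,
    ∃ B ∈ Matrix.unitaryGroup (Fin c → F) ℂ, ∀ ψ : (Fin k → F) → ℂ,
      (weyl χ (fun i => β.repr (u i) 0) (fun i => β.repr (u i) 1) ⊗ₖ B) *ᵥ Q.encode ψ =
        Q.encode ψ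

end Hermitian

end QUENTA

/-! The zeros of C are 1 and, for 1 ≤ i ≤ a, α^(q²+i) with its conjugate. After identifying K^n with
F^n × F^n, the symplectic form governs the commutation of Weyl operators, and the symplectic
complement of D, the Hermitian dual of C, is C itself (`orthogonal_coordSubmodule_hermitianDual`).

The arithmetic core is that 1 is the only zero x for which x^(-q) is again a zero
(`pow_inv_notMem_zeroSet`). Hence vectors of D with coordinate sum 0 lie in C, and D modulo its
radical is a hyperbolic plane over F spanned by constant vectors. One such plane costs one entangled
pair.

For the code itself (`exists_code_of_hyperbolic_pair`), take a Lagrangian M containing a hyperplane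
of D, and a joint eigenvector of the Weyl operators of M. Its translates by labels distinct modulo M
are orthonormal and serve as columns of the encoder. Up to phases, the operators of D only shift the
sender's label, which the receiver can compensate.

An error label orthogonal to D lies in C, so it is zero or has weight above a by the BCH bound for a
consecutive zeros (`eq_zero_of_evalAt_eq_zero`). Any other Weyl error sends the code into an
orthogonal eigenspace. Finally C has codimension at most 2a, so dim D ≤ 4a over F, which leaves room
for k = n + 1 - 4a. -/

namespace QUENTA

/-! ### Inner products and unitary operators -/

section Unitary

variable {X : Type*} [Fintype X]

theorem braket_eq_dotProduct (u v : X → ℂ) : braket u v = star u ⬝ᵥ v := rfl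

theorem braket_smul_left (c : ℂ) (u v : X → ℂ) : braket (c • u) v = star c * braket u v := by
  simp [braket_eq_dotProduct, star_smul, smul_dotProduct]

theorem braket_smul_right (c : ℂ) (u v : X → ℂ) : braket u (c • v) = c * braket u v := by
  simp [braket_eq_dotProduct, dotProduct_smul]

theorem braket_self (u : X → ℂ) : braket u u = ((∑ x, ‖u x‖ ^ 2 : ℝ) : ℂ) := by
  simp only [braket, Complex.ofReal_sum, Complex.ofReal_pow]
  exact Finset.sum_congr rfl fun x _ => by rw [← Complex.conj_mul']; rfl

theorem sum_norm_sq_pos {u : X → ℂ} (hu : u ≠ 0) : 0 < ∑ x, ‖u x‖ ^ 2 := by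
  obtain ⟨x, hx⟩ := Function.ne_iff.1 hu
  exact Finset.sum_pos' (fun _ _ => by positivity)
    ⟨x, Finset.mem_univ x, pow_pos (norm_pos_iff.2 hx) 2⟩

theorem braket_self_ne_zero {u : X → ℂ} (hu : u ≠ 0) : braket u u ≠ 0 := by
  rw [braket_self]
  exact_mod_cast (sum_norm_sq_pos hu).ne'

theorem exists_smul_braket_self_eq_one {u : X → ℂ} (hu : u ≠ 0) :
    ∃ c : ℂ, c ≠ 0 ∧ braket (c • u) (c • u) = 1 := by
  have hr0 := sum_norm_sq_pos hu
  set r : ℝ := ∑ x, ‖u x‖ ^ 2 with hr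
  refine ⟨((Real.sqrt r)⁻¹ : ℝ), ?_, ?_⟩
  · exact_mod_cast inv_ne_zero (Real.sqrt_pos.2 hr0).ne'
  · rw [braket_smul_left, braket_smul_right, braket_self, ← hr]
    have h1 : (Real.sqrt r)⁻¹ * ((Real.sqrt r)⁻¹ * r) = 1 := by
      rw [← mul_assoc, ← mul_inv, Real.mul_self_sqrt hr0.le, inv_mul_cancel₀ hr0.ne']
    have h2 : star (((Real.sqrt r)⁻¹ : ℝ) : ℂ) = (((Real.sqrt r)⁻¹ : ℝ) : ℂ) :=
      Complex.conj_ofReal _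
    rw [h2]
    exact_mod_cast h1

variable [DecidableEq X]

theorem braket_mulVec {M : Matrix X X ℂ} (hM : Mᴴ * M = 1) (u v : X → ℂ) :
    braket (M *ᵥ u) (M *ᵥ v) = braket u v := by
  rw [braket_eq_dotProduct, braket_eq_dotProduct, Matrix.star_mulVec, Matrix.dotProduct_mulVec,
    Matrix.vecMul_vecMul, hM, Matrix.vecMul_one]

/-- Eigenvectors of a unitary operator for different eigenvalues are orthogonal. -/
theorem braket_eq_zero_of_mulVec {G : Matrix X X ℂ} (hG : Gᴴ * G = 1) {l l' : ℂ} {u v : X → ℂ}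
    (hu : G *ᵥ u = l • u) (hv : G *ᵥ v = l' • v) (hl : star l * l' ≠ 1) : braket u v = 0 := by
  have h := braket_mulVec hG u v
  rw [hu, hv, braket_smul_left, braket_smul_right, ← mul_assoc] at h
  by_contra h0
  exact hl (mul_right_cancel₀ h0 (by rw [h, one_mul]))

theorem star_mul_self_of_mulVec {G : Matrix X X ℂ} (hG : Gᴴ * G = 1) {l : ℂ} {u : X → ℂ}
    (hu0 : u ≠ 0) (hu : G *ᵥ u = l • u) : star l * l = 1 := by
  have h := braket_mulVec hG u u
  rw [hu, braket_smul_left, braket_smul_right, ← mul_assoc] at h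
  exact mul_right_cancel₀ (braket_self_ne_zero hu0) (by rw [h, one_mul])

end Unitary

/-- Operators that commute have a common eigenvector. -/
theorem exists_common_eigenvector {ι V : Type*} [AddCommGroup V] [Module ℂ V]
    [FiniteDimensional ℂ V] [Nontrivial V] (f : ι → Module.End ℂ V)
    (hf : ∀ i j, Commute (f i) (f j)) : ∃ v : V, v ≠ 0 ∧ ∀ i, ∃ l : ℂ, f i v = l • v := by
  -- On a nonzero invariant subspace of least dimension each operator is a scalar: by commutativity
  -- its eigenspace there is again invariant. Any nonzero vector of that subspace then works.
  let P : ℕ → Prop := fun d => ∃ U : Submodule ℂ V, U ≠ ⊥ ∧ (∀ i, ∀ v ∈ U, f i v ∈ U) ∧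
    Module.finrank ℂ U = d
  have hP : ∃ d, P d := ⟨_, ⊤, top_ne_bot, by simp, rfl⟩
  classical
  obtain ⟨U, hU0, hUf, hUd⟩ := Nat.find_spec hP
  obtain ⟨v, hvU, hv0⟩ := Submodule.exists_mem_ne_zero_of_ne_bot hU0
  refine ⟨v, hv0, fun i => ?_⟩
  have : Nontrivial U := Submodule.nontrivial_iff_ne_bot.2 hU0
  obtain ⟨l, hl⟩ := Module.End.exists_eigenvalue ((f i).restrict (hUf i))
  obtain ⟨w, hw⟩ := hl.exists_hasEigenvector
  have hwl : f i w = l • (w : V) := by simpa using congrArg Subtype.val hw.apply_eq_smul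
  let U' : Submodule ℂ V := U ⊓ (f i).eigenspace l
  have hU'U : U' ≤ U := inf_le_left
  have hU'0 : U' ≠ ⊥ := by
    refine (Submodule.ne_bot_iff _).2 ⟨w, ⟨w.2, Module.End.mem_eigenspace_iff.2 hwl⟩, ?_⟩
    simpa using hw.2
  have hmin : Nat.find hP ≤ Module.finrank ℂ U' := by
    refine Nat.find_min' hP ⟨U', hU'0, fun j x hx => ⟨hUf j x hx.1, ?_⟩, rfl⟩
    have hx2 := Module.End.mem_eigenspace_iff.1 hx.2
    refine Module.End.mem_eigenspace_iff.2 ?_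
    change (f i * f j) x = _
    rw [(hf i j).eq, Module.End.mul_apply, hx2, map_smul]
  have hEq : U' = U := Submodule.eq_of_le_of_finrank_le hU'U (by rw [hUd]; exact hmin)
  exact ⟨l, Module.End.mem_eigenspace_iff.1 (hEq ▸ hvU : v ∈ U').2⟩

/-! ### Weyl operators and the symplectic form -/

section Weyl

variable {F : Type*} [Field F] {n : ℕ}

/-- The standard symplectic form on `F ^ n × F ^ n`. -/
def symplecticForm (F : Type*) [Field F] (n : ℕ) :
    LinearMap.BilinForm F ((Fin n → F) × (Fin n → F)) :=
  LinearMap.mk₂ F (fun u v => u.1 ⬝ᵥ v.2 - u.2 ⬝ᵥ v.1)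
    (fun u u' v => by simp only [Prod.fst_add, Prod.snd_add, add_dotProduct]; ring)
    (fun c u v => by
      simp only [Prod.smul_fst, Prod.smul_snd, smul_dotProduct, smul_eq_mul]; ring)
    (fun u v v' => by simp only [Prod.fst_add, Prod.snd_add, dotProduct_add]; ring)
    (fun c u v => by
      simp only [Prod.smul_fst, Prod.smul_snd, dotProduct_smul, smul_eq_mul]; ring)

theorem symplecticForm_apply (u v : (Fin n → F) × (Fin n → F)) :
    symplecticForm F n u v = u.1 ⬝ᵥ v.2 - u.2 ⬝ᵥ v.1 := rfl

theorem symplecticForm_isAlt : (symplecticForm F n).IsAlt := fun u => by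
  rw [symplecticForm_apply, dotProduct_comm, sub_self]

theorem symplecticForm_swap (u v : (Fin n → F) × (Fin n → F)) :
    symplecticForm F n u v = -symplecticForm F n v u :=
  (symplecticForm_isAlt.neg_eq v u).symm

theorem symplecticForm_nondegenerate : (symplecticForm F n).Nondegenerate := by
  have h : ∀ u, (∀ v, symplecticForm F n u v = 0) → u = 0 := by
    intro u hu
    refine Prod.ext (funext fun i => ?_) (funext fun i => ?_)
    · simpa [symplecticForm_apply] using hu (0, Pi.single i 1)
    · simpa [symplecticForm_apply] using hu (Pi.single i 1, 0)
  exact ⟨h, fun u hu => h u fun v => by rw [symplecticForm_swap, hu v, neg_zero]⟩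

/-- The kernel of χ may be large, so y ≠ 0 alone does not give χ y ≠ 1. The multiples of y exhaust
F, which is why spaces of labels are taken F-linear. -/
theorem exists_addChar_mul_ne_one {χ : AddChar F ℂ} (hχ : χ ≠ 1) {y : F} (hy : y ≠ 0) :
    ∃ r, χ (r * y) ≠ 1 := by
  obtain ⟨s, hs⟩ := AddChar.ne_one_iff.1 hχ
  exact ⟨s / y, by rwa [div_mul_cancel₀ _ hy]⟩

variable [Fintype F] (χ : AddChar F ℂ)

theorem star_addChar (x : F) : star (χ x) = χ (-x) := (χ.map_neg_eq_conj x).symm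

theorem star_addChar_mul_self (x : F) : star (χ x) * χ x = 1 := by
  rw [star_addChar, ← AddChar.map_add_eq_mul, neg_add_cancel, AddChar.map_zero_eq_one]

variable [DecidableEq F]

/-- The Weyl operator labelled by a vector of the symplectic space. -/
def weylOp (u : (Fin n → F) × (Fin n → F)) : Matrix (Fin n → F) (Fin n → F) ℂ :=
  weyl χ u.1 u.2

theorem weylOp_mul (u v : (Fin n → F) × (Fin n → F)) :
    weylOp χ u * weylOp χ v = χ (u.2 ⬝ᵥ v.1) • weylOp χ (u + v) := by
  ext y x
  simp only [weylOp, Matrix.mul_apply, weyl, Matrix.smul_apply, smul_eq_mul, mul_ite, mul_zero,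
    Finset.sum_ite_eq', Finset.mem_univ, if_true]
  by_cases h : y = x + v.1 + u.1
  · rw [if_pos h, if_pos (by rw [h, Prod.fst_add]; abel), ← AddChar.map_add_eq_mul,
      ← AddChar.map_add_eq_mul]
    congr 1
    change u.2 ⬝ᵥ (x + v.1) + v.2 ⬝ᵥ x = u.2 ⬝ᵥ v.1 + (u.2 + v.2) ⬝ᵥ x
    rw [dotProduct_add, add_dotProduct]; ring
  · rw [if_neg h, if_neg (fun h' => h (by rw [h', Prod.fst_add]; abel)), zero_mul]

omit [Fintype F] in
theorem weylOp_zero : weylOp χ (0 : (Fin n → F) × (Fin n → F)) = 1 := by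
  ext y x
  simp [weylOp, weyl, Matrix.one_apply]

theorem weylOp_comm (u v : (Fin n → F) × (Fin n → F)) :
    weylOp χ u * weylOp χ v = χ (symplecticForm F n v u) • (weylOp χ v * weylOp χ u) := by
  rw [weylOp_mul, weylOp_mul, smul_smul, ← AddChar.map_add_eq_mul, add_comm v u,
    symplecticForm_apply, sub_add_cancel, dotProduct_comm]

theorem weylOp_unitary (u : (Fin n → F) × (Fin n → F)) : (weylOp χ u)ᴴ * weylOp χ u = 1 := by
  ext y x
  simp only [weylOp, Matrix.mul_apply, Matrix.conjTranspose_apply, weyl, Matrix.one_apply, mul_ite,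
    mul_zero, Finset.sum_ite_eq', Finset.mem_univ, if_true]
  by_cases h : y = x
  · rw [if_pos h, h, if_pos rfl, star_addChar_mul_self]
  · rw [if_neg h, if_neg (fun h' => h (add_right_cancel h').symm), star_zero, zero_mul]

/-- The orthogonality relation for characters of `F ^ T`. -/
theorem sum_addChar_dotProduct {χ : AddChar F ℂ} (hχ : χ ≠ 1) {T : Type*} [Fintype T]
    [DecidableEq T] (d : T → F) :
    ∑ b : T → F, χ (b ⬝ᵥ d) = if d = 0 then (Fintype.card (T → F) : ℂ) else 0 := by
  classical
  let g : (T → F) →+ F :=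
    { toFun := fun b => b ⬝ᵥ d, map_zero' := zero_dotProduct _, map_add' := fun _ _ =>
        add_dotProduct _ _ _ }
  have h := AddChar.sum_eq_ite (χ.compAddMonoidHom g)
  have hiff : χ.compAddMonoidHom g = 0 ↔ d = 0 := by
    constructor
    · intro h0
      by_contra hd
      obtain ⟨i, hi⟩ := Function.ne_iff.1 hd
      obtain ⟨r, hr⟩ := exists_addChar_mul_ne_one hχ hi
      refine hr ?_
      have := DFunLike.congr_fun h0 (Pi.single i r)
      simpa [g] using this
    · rintro rfl
      ext b
      simp [g]
  simp only [hiff] at h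
  exact h

end Weyl

/-! ### Detection of errors by stabilizers -/

section Detection

variable {F : Type*} [Field F] [Fintype F] [DecidableEq F] {n k c : ℕ}

/-- Extension by zero of a vector with coordinates in `T`. -/
def extendZero (T : Finset (Fin n)) (b : T → F) : Fin n → F :=
  fun i => if h : i ∈ T then b ⟨i, h⟩ else 0

omit [Fintype F] [DecidableEq F] in
theorem extendZero_of_notMem {T : Finset (Fin n)} (b : T → F) {i : Fin n} (hi : i ∉ T) :
    extendZero T b i = 0 := dif_neg hi

omit [Fintype F] [DecidableEq F] in
theorem extendZero_dotProduct (T : Finset (Fin n)) (b : T → F) (y : Fin n → F) :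
    extendZero T b ⬝ᵥ y = b ⬝ᵥ fun i : T => y i := by
  have h : ∀ i : T, extendZero T b i = b i := fun i => dif_pos i.2
  simp only [dotProduct, ← h]
  rw [Finset.sum_coe_sort T (fun i => extendZero T b i * y i)]
  refine (Finset.sum_subset (Finset.subset_univ T) fun i _ hi => ?_).symm
  rw [extendZero_of_notMem b hi, zero_mul]

omit [Fintype F] [DecidableEq F] in
theorem eq_add_extendZero_iff {T : Finset (Fin n)} {a : T → F} {x y : Fin n → F} :
    x = y + extendZero T a ↔
      (∀ i, i ∉ T → x i = y i) ∧ a = (fun i : T => x i) - fun i : T => y i := by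
  constructor
  · rintro rfl
    refine ⟨fun i hi => by simp [extendZero_of_notMem a hi], funext fun i => ?_⟩
    simp [extendZero]
  · rintro ⟨h, rfl⟩
    funext i
    by_cases hi : i ∈ T
    · simp [extendZero, hi]
    · simp [extendZero, hi, h i hi]

/-- An operator that acts only on the qudits in `T` is a linear combination of Weyl operators whose
labels vanish outside of `T`. -/
theorem ActsOn.mem_span_weylOp {χ : AddChar F ℂ} (hχ : χ ≠ 1) {T : Finset (Fin n)}
    {E : Matrix (Fin n → F) (Fin n → F) ℂ} (hE : ActsOn T E) :
    E ∈ Submodule.span ℂ (Set.range fun p : (T → F) × (T → F) =>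
      weylOp χ (extendZero T p.1, extendZero T p.2)) := by
  obtain ⟨M, hM⟩ := hE
  set N : ℂ := (Fintype.card (T → F) : ℂ) with hN
  have hN0 : N ≠ 0 := Nat.cast_ne_zero.2 Fintype.card_ne_zero
  -- Translation by a carries the shifted diagonal t ↦ M (t + a) t. The coefficients are its Fourier
  -- transform in b, inverted by `sum_addChar_dotProduct`.
  have key : E = ∑ a : T → F, ∑ b : T → F, (N⁻¹ * ∑ t : T → F, χ (-(b ⬝ᵥ t)) * M (t + a) t) •
      weylOp χ (extendZero T a, extendZero T b) := by
    ext x y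
    simp only [Matrix.sum_apply, Matrix.smul_apply, smul_eq_mul]
    have hin : ∀ a : T → F,
        ∑ b : T → F, (N⁻¹ * ∑ t : T → F, χ (-(b ⬝ᵥ t)) * M (t + a) t) *
          weylOp χ (extendZero T a, extendZero T b) x y =
        if x = y + extendZero T a then M ((fun i : T => y i) + a) (fun i : T => y i) else 0 := by
      intro a
      by_cases h : x = y + extendZero T a
      · have hw : ∀ b : T → F, weylOp χ (extendZero T a, extendZero T b) x y =
            χ (b ⬝ᵥ fun i : T => y i) := fun b => by
          rw [← extendZero_dotProduct]; exact if_pos h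
        simp only [hw, if_pos h, Finset.mul_sum, Finset.sum_mul]
        rw [Finset.sum_comm]
        have hterm : ∀ t : T → F, ∑ b : T → F, N⁻¹ * (χ (-(b ⬝ᵥ t)) * M (t + a) t) *
            χ (b ⬝ᵥ fun i : T => y i) = if t = (fun i : T => y i) then M (t + a) t else 0 := by
          intro t
          have : ∀ b : T → F, N⁻¹ * (χ (-(b ⬝ᵥ t)) * M (t + a) t) * χ (b ⬝ᵥ fun i : T => y i) =
              N⁻¹ * M (t + a) t * χ (b ⬝ᵥ ((fun i : T => y i) - t)) := by
            intro b
            rw [dotProduct_sub, sub_eq_add_neg, AddChar.map_add_eq_mul]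
            ring
          simp only [this, ← Finset.mul_sum, sum_addChar_dotProduct hχ, sub_eq_zero]
          by_cases ht : t = fun i : T => y i
          · rw [if_pos ht.symm, if_pos ht, ← hN]
            field_simp
          · rw [if_neg fun h' => ht h'.symm, if_neg ht, mul_zero]
        simp only [hterm, Finset.sum_ite_eq', Finset.mem_univ, if_true]
      · have hw : ∀ b : T → F, weylOp χ (extendZero T a, extendZero T b) x y = 0 :=
          fun b => if_neg h
        simp only [hw, mul_zero, Finset.sum_const_zero, if_neg h]
    simp only [hin, eq_add_extendZero_iff]
    by_cases hxy : ∀ i, i ∉ T → x i = y i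
    · rw [(hM x y).1 hxy, Finset.sum_eq_single ((fun i : T => x i) - fun i : T => y i),
        if_pos ⟨hxy, rfl⟩, add_sub_cancel]
      · exact fun a _ ha => if_neg fun h => ha h.2
      · exact fun h => absurd (Finset.mem_univ _) h
    · rw [(hM x y).2 hxy]
      exact (Finset.sum_eq_zero fun a _ => if_neg fun h => hxy h.1).symm
  rw [key]
  exact Submodule.sum_mem _ fun a _ => Submodule.sum_mem _ fun b _ =>
    Submodule.smul_mem _ _ (Submodule.subset_span ⟨(a, b), rfl⟩)

/-- A code stabilized by the Weyl operators with labels in `D` detects each error of weight less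
than `d` if no nonzero label of weight less than `d` is orthogonal to `D`. -/
theorem Code.minDistGE_of_stabilizer {χ : AddChar F ℂ} (hχ : χ ≠ 1) (Q : Code F n k c) (d : ℕ)
    (D : Submodule F ((Fin n → F) × (Fin n → F)))
    (hD : ∀ u ∈ D, ∃ B ∈ Matrix.unitaryGroup (Fin c → F) ℂ, ∀ ψ : (Fin k → F) → ℂ,
      (weylOp χ u ⊗ₖ B) *ᵥ Q.encode ψ = Q.encode ψ)
    (hd : ∀ T : Finset (Fin n), T.card < d → ∀ e : (Fin n → F) × (Fin n → F), e ≠ 0 →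
      (∀ i ∉ T, e.1 i = 0 ∧ e.2 i = 0) → ∃ u ∈ D, symplecticForm F n u e ≠ 0) :
    Q.MinDistGE d := by
  intro T E hT hE
  -- The detection condition is linear in the error, so it can be tested on Weyl operators.
  let S : Submodule ℂ (Matrix (Fin n → F) (Fin n → F) ℂ) :=
    { carrier := {E | ∃ l : ℂ, ∀ φ ψ : (Fin k → F) → ℂ,
        braket (Q.encode φ) ((E ⊗ₖ (1 : Matrix (Fin c → F) (Fin c → F) ℂ)) *ᵥ Q.encode ψ) =
          l * braket (Q.encode φ) (Q.encode ψ)}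
      zero_mem' := ⟨0, fun φ ψ => by
        rw [Matrix.zero_kronecker, Matrix.zero_mulVec]; simp [braket]⟩
      add_mem' := by
        rintro E E' ⟨l, hl⟩ ⟨l', hl'⟩
        refine ⟨l + l', fun φ ψ => ?_⟩
        rw [Matrix.add_kronecker, Matrix.add_mulVec, add_mul, ← hl, ← hl']
        simp only [braket_eq_dotProduct, dotProduct_add]
      smul_mem' := by
        rintro r E ⟨l, hl⟩
        refine ⟨r * l, fun φ ψ => ?_⟩
        rw [Matrix.smul_kronecker, Matrix.smul_mulVec, braket_smul_right, hl, mul_assoc] }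
  suffices h : Submodule.span ℂ (Set.range fun p : (T → F) × (T → F) =>
      weylOp χ (extendZero T p.1, extendZero T p.2)) ≤ S from h (hE.mem_span_weylOp hχ)
  refine Submodule.span_le.2 ?_
  rintro _ ⟨p, rfl⟩
  set e : (Fin n → F) × (Fin n → F) := (extendZero T p.1, extendZero T p.2) with he
  by_cases he0 : e = 0
  · refine ⟨1, fun φ ψ => ?_⟩
    simp only [← he, he0, weylOp_zero, Matrix.one_kronecker_one, Matrix.one_mulVec, one_mul]
  obtain ⟨u, huD, hu⟩ := hd T hT e he0 fun i hi =>
    ⟨extendZero_of_notMem _ hi, extendZero_of_notMem _ hi⟩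
  obtain ⟨r, hr⟩ := exists_addChar_mul_ne_one hχ (y := symplecticForm F n e u)
    (by rw [symplecticForm_swap]; exact neg_ne_zero.2 hu)
  obtain ⟨B, hB, hfix⟩ := hD (r • u) (D.smul_mem r huD)
  -- Encoded states have eigenvalue 1 under the stabilizing unitary. The error changes this to the
  -- value `hr` separates from 1, so the two states are orthogonal.
  refine ⟨0, fun φ ψ => ?_⟩
  rw [zero_mul]
  have hG : (weylOp χ (r • u) ⊗ₖ B)ᴴ * (weylOp χ (r • u) ⊗ₖ B) = 1 := by
    rw [Matrix.conjTranspose_kronecker, ← Matrix.mul_kronecker_mul, weylOp_unitary,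
      ← Matrix.star_eq_conjTranspose B, Matrix.mem_unitaryGroup_iff'.1 hB,
      Matrix.one_kronecker_one]
  refine braket_eq_zero_of_mulVec hG (l := 1) (l' := χ (r * symplecticForm F n e u))
    (by rw [one_smul, hfix]) ?_ (by rwa [star_one, one_mul])
  have hcomm : weylOp χ (r • u) * weylOp χ e =
      χ (r * symplecticForm F n e u) • (weylOp χ e * weylOp χ (r • u)) := by
    rw [weylOp_comm, map_smul, smul_eq_mul]
  conv_rhs => rw [← hfix ψ]
  rw [Matrix.mulVec_mulVec, Matrix.mulVec_mulVec, ← Matrix.mul_kronecker_mul,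
    ← Matrix.mul_kronecker_mul, mul_one, one_mul, hcomm, Matrix.smul_kronecker,
    Matrix.smul_mulVec]

end Detection

/-! ### Lagrangian subspaces -/

section Lagrangian

variable {F V : Type*} [Field F] [AddCommGroup V] [Module F V] [FiniteDimensional F V]
  {B : LinearMap.BilinForm F V}

/-- An isotropic subspace is contained in a Lagrangian subspace. -/
theorem exists_le_lagrangian (hB : B.IsAlt) {I : Submodule F V} (hI : I ≤ B.orthogonal I) :
    ∃ M : Submodule F V, I ≤ M ∧ B.orthogonal M = M := by
  -- M is a maximal isotropic subspace above I. As the form is alternating, any v orthogonal to M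
  -- could be adjoined to it.
  obtain ⟨M, ⟨hIM, hM⟩, hmax⟩ := (wellFounded_gt (α := Submodule F V)).has_min
    {M | I ≤ M ∧ M ≤ B.orthogonal M} ⟨I, le_rfl, hI⟩
  refine ⟨M, hIM, le_antisymm (fun v hv => ?_) hM⟩
  by_contra hvM
  have hBM : ∀ m ∈ M, ∀ m' ∈ M, B m m' = 0 := fun m hm m' hm' => hM hm' m hm
  have hBv : ∀ m ∈ M, B m v = 0 := fun m hm => hv m hm
  refine hmax (M ⊔ Submodule.span F {v}) ⟨hIM.trans le_sup_left, ?_⟩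
    (lt_of_le_of_ne le_sup_left fun h => hvM ?_)
  · intro x hx y hy
    obtain ⟨m, hm, w, hw, rfl⟩ := Submodule.mem_sup.1 hx
    obtain ⟨m', hm', w', hw', rfl⟩ := Submodule.mem_sup.1 hy
    obtain ⟨s, rfl⟩ := Submodule.mem_span_singleton.1 hw
    obtain ⟨s', rfl⟩ := Submodule.mem_span_singleton.1 hw'
    have h1 : B v m = 0 := by rw [← hB.neg_eq, hBv m hm, neg_zero]
    change B _ _ = 0
    simp [hBM m' hm' m hm, hBv m' hm', h1, hB.self_eq_zero v]
  · rw [h]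
    exact Submodule.mem_sup_right (Submodule.mem_span_singleton_self v)

/-- If the restriction of a symplectic form to `D` has rank two, witnessed by a hyperbolic pair
`h₁, h₂`, there is a Lagrangian subspace containing `D` up to multiples of `h₂`, and a large
subspace of the orthogonal complement of `D` that is independent of it. -/
theorem exists_lagrangian_and_transversal (hB : B.IsAlt) (hnd : B.Nondegenerate)
    {D : Submodule F V} {h₁ h₂ : V} (hh₁ : h₁ ∈ D) (hh₂ : h₂ ∈ D) (h₁₂ : B h₁ h₂ ≠ 0)
    (hrad : ∀ u ∈ D, B h₁ u = 0 → B h₂ u = 0 → u ∈ B.orthogonal D) :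
    ∃ M T : Submodule F V, B.orthogonal M = M ∧ T ≤ B.orthogonal D ∧
      (∀ t ∈ T, ∀ s : F, t + s • h₂ ∈ M → t = 0 ∧ s = 0) ∧
      (∀ u ∈ D, ∃ r : F, u - r • h₂ ∈ M) ∧
      Module.finrank F M + 1 ≤ Module.finrank F T + Module.finrank F D := by
  let I : Submodule F V := D ⊓ LinearMap.ker (B h₁)
  have h₂₁ : B h₂ h₁ ≠ 0 := by rw [← hB.neg_eq]; exact neg_ne_zero.2 h₁₂
  -- Subtracting a multiple of h₁ makes v orthogonal to h₂ as well, hence a vector of the radical;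
  -- h₁ itself is orthogonal to I.
  have hI : I ≤ B.orthogonal I := by
    rintro v ⟨hvD, hv⟩ u ⟨huD, hu⟩
    have hv : B h₁ v = 0 := hv
    have hu : B h₁ u = 0 := hu
    have h := hrad (v - (B h₂ v / B h₂ h₁) • h₁) (D.sub_mem hvD (D.smul_mem _ hh₁))
      (by simp [hv, hB.self_eq_zero]) (by simp [h₂₁]) u huD
    have h0 : B u h₁ = 0 := by rw [← hB.neg_eq, hu, neg_zero]
    change B _ _ = 0 at h
    change B _ _ = 0
    simpa [h0] using h
  obtain ⟨M, hIM, hM⟩ := exists_le_lagrangian hB hI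
  have hMM : ∀ m ∈ M, ∀ m' ∈ M, B m m' = 0 := fun m hm m' hm' => (hM.ge hm') m hm
  have h₁M : h₁ ∈ M := hIM ⟨hh₁, hB.self_eq_zero h₁⟩
  have h₂M : h₂ ∉ M := fun h => h₁₂ (hMM _ h₁M _ h)
  -- T complements M ∩ D^⊥ in D^⊥. Pairing t + s • h₂ with h₁ ∈ M isolates s.
  obtain ⟨T, hdis, hsup⟩ := IsModularLattice.exists_disjoint_and_sup_eq
    (inf_le_right : M ⊓ B.orthogonal D ≤ B.orthogonal D)
  have hTD : T ≤ B.orthogonal D := hsup ▸ le_sup_right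
  refine ⟨M, T, hM, hTD, fun t ht s hts => ?_, fun u hu => ⟨B h₁ u / B h₁ h₂, hIM ⟨?_, ?_⟩⟩, ?_⟩
  · have h1 := hMM _ h₁M _ hts
    have h2 : B h₁ t = 0 := hTD ht h₁ hh₁
    have hs : s = 0 := by simpa [h2, h₁₂] using h1
    subst hs
    refine ⟨Submodule.disjoint_def.1 hdis t ⟨?_, hTD ht⟩ ht, rfl⟩
    simpa using hts
  · exact D.sub_mem hu (D.smul_mem _ hh₂)
  · change B h₁ _ = 0
    simp [h₁₂]
  -- Since M ∩ D^⊥ lies in (M + D)^⊥, dim T ≥ dim (M + D) - dim D = dim M - dim (M ∩ D). The extra 1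
  -- comes from h₂ ∈ D \ M.
  · have e1 := Submodule.finrank_sup_add_finrank_inf_eq (M ⊓ B.orthogonal D) T
    rw [hsup, hdis.eq_bot, finrank_bot, LinearMap.BilinForm.finrank_orthogonal hnd] at e1
    have e2 : Module.finrank F (M ⊓ B.orthogonal D : Submodule F V) ≤
        Module.finrank F (B.orthogonal (M ⊔ D)) := by
      refine Submodule.finrank_mono ?_
      rintro x ⟨hxM, hxD⟩ y hy
      obtain ⟨m, hm, d, hd, rfl⟩ := Submodule.mem_sup.1 hy
      have h1 : B d x = 0 := hxD d hd
      change B _ _ = 0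
      simp [hMM m hm x hxM, h1]
    rw [LinearMap.BilinForm.finrank_orthogonal hnd] at e2
    have e3 := Submodule.finrank_sup_add_finrank_inf_eq M D
    have e4 : Module.finrank F (M ⊓ D : Submodule F V) < Module.finrank F D :=
      Submodule.finrank_lt_finrank_of_lt
        (lt_of_le_of_ne inf_le_right fun h => h₂M (h.ge hh₂).1)
    have e5 := Submodule.finrank_le (M ⊔ D)
    have e6 := Submodule.finrank_le D
    omega

end Lagrangian

/-! ### The code stabilized by a space of Weyl operators -/

section Stabilized

theorem maxEntangled_one_apply (A : Type*) [Fintype A] [DecidableEq A] (s y : Fin 1 → A) :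
    maxEntangled A 1 (s, y) =
      if s = y then ((Real.sqrt (Fintype.card A) : ℝ) : ℂ)⁻¹ else 0 := by
  simp [maxEntangled, funext_iff, Fin.forall_fin_one]

/-- Contraction with the entangled pair makes the receiver's basis label equal to the sender's input
label. -/
theorem Code.encode_apply_one {A : Type*} [Fintype A] [DecidableEq A] {n k : ℕ}
    (Q : Code A n k 1) (ψ : (Fin k → A) → ℂ) (x : Fin n → A) (y : Fin 1 → A) :
    Q.encode ψ (x, y) =
      ((Real.sqrt (Fintype.card A) : ℝ) : ℂ)⁻¹ * ∑ t, ψ t * Q.encoder x (t, y) := by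
  simp only [Code.encode, Matrix.mulVec, dotProduct, Fintype.sum_prod_type,
    Matrix.kroneckerMap_apply, maxEntangled_one_apply, Matrix.one_apply, mul_ite, ite_mul, mul_one,
    mul_zero, zero_mul, Finset.sum_ite_eq, Finset.mem_univ, if_true,
    Finset.mul_sum]
  exact Finset.sum_congr rfl fun t _ => by ring

theorem kronecker_mulVec_apply {X Y : Type*} [Fintype X] [Fintype Y] (M : Matrix X X ℂ)
    (B : Matrix Y Y ℂ) (Φ : X × Y → ℂ) (x : X) (y : Y) :
    ((M ⊗ₖ B) *ᵥ Φ) (x, y) = ∑ y', B y y' * (M *ᵥ fun x' => Φ (x', y')) x := by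
  simp only [Matrix.mulVec, dotProduct, Fintype.sum_prod_type, Matrix.kroneckerMap_apply,
    Finset.mul_sum]
  rw [Finset.sum_comm]
  exact Finset.sum_congr rfl fun _ _ => Finset.sum_congr rfl fun _ _ => by ring

/-- The unitary that shifts the alphabet by `r` and multiplies with phases. -/
theorem shift_mem_unitaryGroup {Y : Type*} [Fintype Y] [DecidableEq Y] [AddCommGroup Y] (r : Y)
    (p : Y → ℂ) (hp : ∀ y, star (p y) * p y = 1) :
    (Matrix.of fun y y' => if y = y' + r then p y' else 0) ∈ Matrix.unitaryGroup Y ℂ := by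
  rw [Matrix.mem_unitaryGroup_iff', Matrix.star_eq_conjTranspose]
  ext y x
  simp only [Matrix.mul_apply, Matrix.conjTranspose_apply, Matrix.of_apply, Matrix.one_apply,
    mul_ite, mul_zero, Finset.sum_ite_eq', Finset.mem_univ, if_true]
  by_cases h : y = x
  · rw [if_pos h, h, if_pos rfl, hp]
  · rw [if_neg h, if_neg (fun h' => h (add_right_cancel h').symm), star_zero, zero_mul]

variable {F : Type*} [Field F] [Fintype F] [DecidableEq F] {n k : ℕ}

/-- The Weyl operators with labels in an isotropic subspace have a common eigenvector. -/
theorem exists_weylOp_eigenvector (χ : AddChar F ℂ)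
    {M : Submodule F ((Fin n → F) × (Fin n → F))} (hM : M ≤ (symplecticForm F n).orthogonal M) :
    ∃ v : (Fin n → F) → ℂ, braket v v = 1 ∧
      ∀ m ∈ M, ∃ l : ℂ, star l * l = 1 ∧ weylOp χ m *ᵥ v = l • v := by
  obtain ⟨v, hv0, hv⟩ := exists_common_eigenvector
    (fun m : M => Matrix.toLin' (weylOp χ (m : (Fin n → F) × (Fin n → F)))) fun m m' => by
      have h : symplecticForm F n m' m = 0 := hM m.2 m' m'.2
      change _ * _ = _ * _
      rw [Module.End.mul_eq_comp, Module.End.mul_eq_comp, ← Matrix.toLin'_mul,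
        ← Matrix.toLin'_mul, weylOp_comm, h, AddChar.map_zero_eq_one, one_smul]
  obtain ⟨c, hc0, hc⟩ := exists_smul_braket_self_eq_one hv0
  refine ⟨c • v, hc, fun m hm => ?_⟩
  obtain ⟨l, hl⟩ := hv ⟨m, hm⟩
  have hl' : weylOp χ m *ᵥ v = l • v := hl
  exact ⟨l, star_mul_self_of_mulVec (weylOp_unitary χ m) hv0 hl', by
    rw [Matrix.mulVec_smul, hl', smul_comm]⟩

theorem weylOp_mulVec_comm (χ : AddChar F ℂ) (u v : (Fin n → F) × (Fin n → F))
    (w : (Fin n → F) → ℂ) : weylOp χ u *ᵥ (weylOp χ v *ᵥ w) =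
      χ (symplecticForm F n v u) • (weylOp χ v *ᵥ (weylOp χ u *ᵥ w)) := by
  rw [Matrix.mulVec_mulVec, weylOp_comm, Matrix.smul_mulVec, ← Matrix.mulVec_mulVec]

/-- Let the restriction of the symplectic form to `D` have rank two. There is an
entanglement-assisted code with one maximally entangled pair that is stabilized by the Weyl
operators with labels in `D`. -/
theorem exists_code_of_hyperbolic_pair {χ : AddChar F ℂ} (hχ : χ ≠ 1)
    (D : Submodule F ((Fin n → F) × (Fin n → F))) {h₁ h₂ : (Fin n → F) × (Fin n → F)}
    (hh₁ : h₁ ∈ D) (hh₂ : h₂ ∈ D) (h₁₂ : symplecticForm F n h₁ h₂ ≠ 0)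
    (hrad : ∀ u ∈ D, symplecticForm F n h₁ u = 0 → symplecticForm F n h₂ u = 0 →
      u ∈ (symplecticForm F n).orthogonal D)
    (hk : k + Module.finrank F D ≤ n + 1) :
    ∃ Q : Code F n k 1, ∀ u ∈ D, ∃ B ∈ Matrix.unitaryGroup (Fin 1 → F) ℂ,
      ∀ ψ : (Fin k → F) → ℂ, (weylOp χ u ⊗ₖ B) *ᵥ Q.encode ψ = Q.encode ψ := by
  obtain ⟨M, T, hM, hTD, hTM, hDM, hdim⟩ := exists_lagrangian_and_transversal symplecticForm_isAlt
    symplecticForm_nondegenerate hh₁ hh₂ h₁₂ hrad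
  have hMn : Module.finrank F M = n := by
    have h := LinearMap.BilinForm.finrank_orthogonal (symplecticForm_nondegenerate (F := F) (n := n)) M
    rw [hM, Module.finrank_prod, Module.finrank_fin_fun] at h
    have h' := Submodule.finrank_le M
    rw [Module.finrank_prod, Module.finrank_fin_fun] at h'
    omega
  obtain ⟨φ, hφ⟩ := (finrank_le_iff_exists_linearMap (R := F) (M := Fin k → F) (M' := T)).1
    (by rw [Module.finrank_fin_fun]; omega)
  obtain ⟨v₀, hv₀, hv₀M⟩ := exists_weylOp_eigenvector χ hM.ge
  choose! l hl1 hl using hv₀M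
  -- The logical label moves v₀ along T, and the sender's half moves it along h₂. Each `vec p` is a
  -- joint eigenvector for M, with a character determined by `lab p`.
  let vec : (Fin k → F) × (Fin 1 → F) → (Fin n → F) → ℂ := fun p =>
    weylOp χ (φ p.1 : (Fin n → F) × (Fin n → F)) *ᵥ (weylOp χ (p.2 0 • h₂) *ᵥ v₀)
  let lab : (Fin k → F) × (Fin 1 → F) → (Fin n → F) × (Fin n → F) := fun p =>
    (φ p.1 : (Fin n → F) × (Fin n → F)) + p.2 0 • h₂
  have hvec : ∀ m ∈ M, ∀ p, weylOp χ m *ᵥ vec p =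
      (χ (symplecticForm F n (lab p) m) * l m) • vec p := by
    intro m hm p
    simp only [vec, lab]
    rw [weylOp_mulVec_comm χ m, weylOp_mulVec_comm χ m (_ • h₂), hl m hm, map_add, LinearMap.add_apply,
      AddChar.map_add_eq_mul]
    simp only [Matrix.mulVec_smul, smul_smul, mul_assoc]
  have hiso : ∀ p p', braket (vec p) (vec p') = if p = p' then 1 else 0 := by
    intro p p'
    split_ifs with h
    · subst h
      rw [braket_mulVec (weylOp_unitary χ _), braket_mulVec (weylOp_unitary χ _), hv₀]
    -- Since M is its own complement, labels distinct modulo M give distinct characters of M, hence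
    -- orthogonal vectors.
    · have hlab : lab p' - lab p ∉ M := by
        intro hmem
        have h1 : lab p' - lab p = (φ (p'.1 - p.1) : (Fin n → F) × (Fin n → F)) +
            (p'.2 0 - p.2 0) • h₂ := by
          simp only [lab, map_sub, Submodule.coe_sub, sub_smul]; abel
        rw [h1] at hmem
        obtain ⟨h2, h3⟩ := hTM _ (φ (p'.1 - p.1)).2 _ hmem
        have h4 : p'.1 - p.1 = 0 := hφ (by rw [map_zero]; exact Subtype.ext h2)
        refine h (Prod.ext (sub_eq_zero.1 h4).symm (funext fun i => ?_))
        rw [Fin.fin_one_eq_zero i]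
        exact (sub_eq_zero.1 h3).symm
      have hlab' : ∃ m ∈ M, symplecticForm F n m (lab p' - lab p) ≠ 0 := by
        by_contra! hcon
        exact hlab (hM.le fun m hm => hcon m hm)
      obtain ⟨m, hm, hne⟩ := hlab'
      obtain ⟨r, hr⟩ := exists_addChar_mul_ne_one hχ (y := symplecticForm F n (lab p' - lab p) m)
        (by rw [symplecticForm_swap]; exact neg_ne_zero.2 hne)
      have hrm : r • m ∈ M := M.smul_mem r hm
      refine braket_eq_zero_of_mulVec (weylOp_unitary χ (r • m)) (hvec _ hrm p) (hvec _ hrm p') ?_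
      rw [map_sub, LinearMap.sub_apply, mul_sub, sub_eq_add_neg, AddChar.map_add_eq_mul] at hr
      simp only [map_smul, smul_eq_mul, star_mul', star_addChar]
      intro h1
      refine hr ?_
      linear_combination h1 - χ (r * symplecticForm F n (lab p') m) *
        χ (-(r * symplecticForm F n (lab p) m)) * hl1 _ hrm
  let Q : Code F n k 1 :=
    { encoder := Matrix.of fun x p => vec p x
      isometry := by
        ext p p'
        rw [Matrix.mul_apply, Matrix.one_apply]
        exact hiso p p' }
  refine ⟨Q, fun u hu => ?_⟩
  obtain ⟨r, hr⟩ := hDM u hu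
  set m := u - r • h₂ with hm
  -- As u = m + r • h₂ and m ∈ M acts on v₀ by a scalar, u shifts s by r up to a phase. It commutes
  -- with the translations along T ≤ D^⊥.
  have hphase : ∀ s : F, ∃ p : ℂ, star p * p = 1 ∧ weylOp χ u *ᵥ (weylOp χ (s • h₂) *ᵥ v₀) =
      p • (weylOp χ ((s + r) • h₂) *ᵥ v₀) := by
    intro s
    set a := u.2 ⬝ᵥ (s • h₂).1
    set b := ((s + r) • h₂).2 ⬝ᵥ m.1
    have h1 : weylOp χ u * weylOp χ (s • h₂) =
        χ (a - b) • (weylOp χ ((s + r) • h₂) * weylOp χ m) := by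
      rw [weylOp_mul, weylOp_mul, smul_smul, ← AddChar.map_add_eq_mul, sub_add_cancel]
      congr 2
      rw [hm, add_smul]; abel
    refine ⟨χ (a - b) * l m, ?_, ?_⟩
    · rw [star_mul']
      linear_combination star (l m) * l m * star_addChar_mul_self χ (a - b) + hl1 m hr
    · rw [Matrix.mulVec_mulVec, h1, Matrix.smul_mulVec, ← Matrix.mulVec_mulVec, hl m hr,
        Matrix.mulVec_smul, smul_smul]
  choose p hp1 hp using hphase
  have hshift : ∀ (t : Fin k → F) (y : Fin 1 → F), weylOp χ u *ᵥ vec (t, y) =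
      p (y 0) • vec (t, y + fun _ => r) := by
    intro t y
    have h0 : symplecticForm F n (φ t : (Fin n → F) × (Fin n → F)) u = 0 := by
      rw [symplecticForm_swap, neg_eq_zero]; exact hTD (φ t).2 u hu
    simp only [vec]
    rw [weylOp_mulVec_comm, h0, AddChar.map_zero_eq_one, one_smul, hp, Matrix.mulVec_smul]
    rfl
  -- The receiver shifts by the same r and multiplies by the conjugate phases, which restores the
  -- correlated sum.
  refine ⟨_, shift_mem_unitaryGroup (fun _ : Fin 1 => r) (fun y => star (p (y 0)))
    (fun y => by rw [star_star, mul_comm, hp1]), fun ψ => ?_⟩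
  ext ⟨x, y⟩
  rw [kronecker_mulVec_apply]
  set κ : ℂ := ((Real.sqrt (Fintype.card F) : ℝ) : ℂ)⁻¹ with hκ
  have hslice : ∀ y' : Fin 1 → F, (weylOp χ u *ᵥ fun x' => Q.encode ψ (x', y')) x =
      κ * ∑ t, ψ t * (p (y' 0) * vec (t, y' + fun _ => r) x) := by
    intro y'
    have : (fun x' => Q.encode ψ (x', y')) = κ • ∑ t, ψ t • vec (t, y') := by
      ext x'
      rw [Code.encode_apply_one]
      simp [hκ, Q]
    rw [this, Matrix.mulVec_smul, Matrix.mulVec_sum]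
    simp [Matrix.mulVec_smul, hshift]
  simp only [hslice, Matrix.of_apply]
  rw [Finset.sum_eq_single (y - fun _ => r), if_pos (sub_add_cancel _ _).symm,
    Code.encode_apply_one, sub_add_cancel]
  · simp only [Finset.mul_sum, Q, Matrix.of_apply]
    refine Finset.sum_congr rfl fun t _ => ?_
    linear_combination κ * ψ t * vec (t, y) x * hp1 ((y - fun _ => r : Fin 1 → F) 0)
  · intro y' _ hy'
    rw [if_neg (fun h => hy' (by rw [h, add_sub_cancel_right])), zero_mul]
  · exact fun h => absurd (Finset.mem_univ _) h

end Stabilized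

/-! ### Finite fields -/

section FiniteFields

/-- The map f serves only to give R the characteristic of F; the power map is then an iterate of
Frobenius. -/
theorem exists_ringHom_pow_card {F R : Type*} [Field F] [Fintype F] [Field R] (f : F →+* R) :
    ∃ φ : R →+* R, ∀ x, φ x = x ^ Fintype.card F := by
  obtain ⟨p, hp, m, hprime, hm⟩ := FiniteField.card' F
  have := charP_of_injective_ringHom f.injective p
  have : Fact p.Prime := ⟨hprime⟩
  exact ⟨iterateFrobenius R p m, fun x => by rw [iterateFrobenius_def, hm]⟩

theorem sum_pow_card {F R : Type*} [Field F] [Fintype F] [Field R] (f : F →+* R) {ι : Type*}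
    (s : Finset ι) (g : ι → R) :
    (∑ i ∈ s, g i) ^ Fintype.card F = ∑ i ∈ s, g i ^ Fintype.card F := by
  obtain ⟨φ, hφ⟩ := exists_ringHom_pow_card f
  simp only [← hφ, map_sum]

theorem add_pow_card {F R : Type*} [Field F] [Fintype F] [Field R] (f : F →+* R) (x y : R) :
    (x + y) ^ Fintype.card F = x ^ Fintype.card F + y ^ Fintype.card F := by
  obtain ⟨φ, hφ⟩ := exists_ringHom_pow_card f
  simp only [← hφ, map_add]

theorem card_le_of_forall_pow_eq {L : Type*} [Field L] {m : ℕ} (hm : 1 < m) (s : Finset L)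
    (hs : ∀ x ∈ s, x ^ m = x) : s.card ≤ m := by
  have hne : (Polynomial.X ^ m - Polynomial.X : Polynomial L) ≠ 0 :=
    FiniteField.X_pow_card_sub_X_ne_zero L hm
  rw [← FiniteField.X_pow_card_sub_X_natDegree_eq L hm]
  refine Polynomial.card_le_degree_of_subset_roots fun x hx => ?_
  rw [Polynomial.mem_roots hne]
  simp [hs x hx]

/-- The image of K already supplies all |K| possible roots of X^|K| - X. -/
theorem exists_algebraMap_eq_of_pow_card_eq {K L : Type*} [Field K] [Fintype K] [Field L]
    [Algebra K L] {x : L} (hx : x ^ Fintype.card K = x) : ∃ k : K, algebraMap K L k = x := by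
  classical
  by_contra! h
  have h1 := card_le_of_forall_pow_eq (Fintype.one_lt_card (α := K))
    (insert x (Finset.univ.image (algebraMap K L))) (by
      intro y hy
      rcases Finset.mem_insert.1 hy with rfl | hy
      · exact hx
      · obtain ⟨k, -, rfl⟩ := Finset.mem_image.1 hy
        rw [← map_pow, FiniteField.pow_card])
  rw [Finset.card_insert_of_notMem (by simpa using h), Finset.card_image_of_injective _
    (algebraMap K L).injective, Finset.card_univ] at h1
  omega

theorem exists_pow_ne_self {L : Type*} [Field L] [Fintype L] {m : ℕ} (hm : 1 < m)
    (hL : m < Fintype.card L) : ∃ x : L, x ^ m ≠ x := by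
  by_contra! h
  exact absurd (card_le_of_forall_pow_eq hm Finset.univ fun x _ => h x) (by simpa using hL)

/-- For m = q² this is nontriviality of the trace from L to K. If it failed, x = 1 would give 1 =
-1, and then every x would satisfy x^m = x. -/
theorem exists_add_pow_ne_zero {L : Type*} [Field L] [Fintype L] {m : ℕ} (hm : 1 < m)
    (hL : m < Fintype.card L) : ∃ x : L, x + x ^ m ≠ 0 := by
  by_contra! h
  obtain ⟨x, hx⟩ := exists_pow_ne_self hm hL
  have h1 : (1 : L) = -1 := by
    have := h 1
    rw [one_pow] at this
    exact eq_neg_of_add_eq_zero_left this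
  refine hx ?_
  rw [eq_neg_of_add_eq_zero_right (h x), ← neg_one_mul, ← h1, one_mul]

end FiniteFields

/-! ### Codes given by their zeros -/

section ZeroCode

variable {K L : Type*} [Field K] [Field L] [Algebra K L] {n : ℕ}

/-- The value at `x` of the polynomial with coefficients `v`. -/
def evalAt (v : Fin n → K) (x : L) : L := ∑ i : Fin n, algebraMap K L (v i) * x ^ (i : ℕ)

/-- The code of all vectors whose polynomials vanish on `X`. -/
def zeroCode (K : Type*) {L : Type*} [Field K] [Field L] [Algebra K L] (n : ℕ) (X : Set L) :
    Submodule K (Fin n → K) where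
  carrier := {v | ∀ x ∈ X, evalAt v x = 0}
  zero_mem' := fun x _ => by simp [evalAt]
  add_mem' := fun {u v} hu hv x hx => by
    have h1 := hu x hx
    have h2 := hv x hx
    simp only [evalAt] at h1 h2
    simp [evalAt, add_mul, Finset.sum_add_distrib, h1, h2]
  smul_mem' := fun r u hu x hx => by
    have h1 := hu x hx
    simp only [evalAt] at h1
    simp [evalAt, mul_assoc, ← Finset.mul_sum, h1]

theorem mem_zeroCode {X : Set L} {v : Fin n → K} :
    v ∈ zeroCode K n X ↔ ∀ x ∈ X, evalAt v x = 0 := Iff.rfl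

/-- The shift divides the value at x by x; the wrapped coefficient fits in because x^n = 1. -/
theorem isCyclicCode_zeroCode {X : Set L} (hX : ∀ x ∈ X, x ^ n = 1) :
    IsCyclicCode (zeroCode K n X) := by
  intro v hv x hx
  rcases n with _ | n
  · simp [evalAt]
  have hx0 : x ≠ 0 := by
    rintro rfl
    simpa using hX 0 hx
  refine (mul_eq_zero.1 ?_).resolve_left hx0
  rw [← hv x hx, evalAt, evalAt, Finset.mul_sum,
    ← Equiv.sum_comp (finRotate (n + 1)) fun i => algebraMap K L (v i) * x ^ (i : ℕ)]
  refine Finset.sum_congr rfl fun i _ => ?_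
  have hi : x ^ (finRotate (n + 1) i : ℕ) = x * x ^ (i : ℕ) := by
    rw [coe_finRotate]
    split_ifs with h
    · rw [h, Fin.val_last, ← pow_succ', hX x hx, pow_zero]
    · rw [pow_succ']
  rw [hi]; ring

/-- A form of the BCH bound. -/
theorem eq_zero_of_evalAt_eq_zero {α : L} (hα : IsPrimitiveRoot α n) {b d : ℕ} {v : Fin n → K}
    (hv : ∀ j < d, evalAt v (α ^ (b + j)) = 0) {T : Finset (Fin n)} (hT : T.card ≤ d)
    (hvT : ∀ i ∉ T, v i = 0) : v = 0 := by
  classical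
  by_contra hne
  obtain ⟨i₀, hi₀⟩ := Function.ne_iff.1 hne
  have hi₀T : i₀ ∈ T := by
    by_contra h
    exact hi₀ (hvT i₀ h)
  have hα0 : α ≠ 0 := hα.ne_zero (by have := i₀.2; omega)
  -- As deg p < d, weighting the coordinates by p(α^i) gives a combination of the prescribed zero
  -- values, yet only the term at i₀ survives.
  let p : Polynomial L :=
    ∏ i ∈ T.erase i₀, (Polynomial.X - Polynomial.C (α ^ (i : ℕ)))
  have hpdeg : p.natDegree < d := by
    rw [Polynomial.natDegree_prod_of_monic _ _ fun i _ => Polynomial.monic_X_sub_C _]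
    simp only [Polynomial.natDegree_X_sub_C, Finset.sum_const, smul_eq_mul, mul_one]
    exact lt_of_lt_of_le (Finset.card_erase_lt_of_mem hi₀T) hT
  have hsum : ∑ i : Fin n, algebraMap K L (v i) * (α ^ b) ^ (i : ℕ) * p.eval (α ^ (i : ℕ)) = 0 := by
    simp only [Polynomial.eval_eq_sum_range' hpdeg, Finset.mul_sum]
    rw [Finset.sum_comm]
    refine Finset.sum_eq_zero fun j hj => ?_
    have h := hv j (Finset.mem_range.1 hj)
    rw [evalAt] at h
    rw [← mul_zero (p.coeff j), ← h, Finset.mul_sum]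
    refine Finset.sum_congr rfl fun i _ => ?_
    rw [pow_add, mul_pow, ← pow_mul α (i : ℕ) j, mul_comm (i : ℕ) j, pow_mul α j]
    ring
  rw [Finset.sum_eq_single i₀] at hsum
  · refine mul_ne_zero (mul_ne_zero ?_ (pow_ne_zero _ (pow_ne_zero _ hα0))) ?_ hsum
    · exact fun h => hi₀ ((map_eq_zero _).1 h)
    · rw [Polynomial.eval_prod]
      refine Finset.prod_ne_zero_iff.2 fun i hi => ?_
      rw [Polynomial.eval_sub, Polynomial.eval_X, Polynomial.eval_C, sub_ne_zero]
      exact fun h => (Finset.mem_erase.1 hi).1 (Fin.ext (hα.pow_inj i.2 i₀.2 h.symm))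
  · intro i _ hi
    by_cases hiT : i ∈ T
    · have : p.eval (α ^ (i : ℕ)) = 0 := by
        rw [Polynomial.eval_prod]
        exact Finset.prod_eq_zero (Finset.mem_erase.2 ⟨hi, hiT⟩) (by simp)
      rw [this, mul_zero]
    · rw [hvT i hiT, map_zero, zero_mul, zero_mul]
  · exact fun h => absurd (Finset.mem_univ _) h

theorem sum_pow_eq_zero {x : L} (hx : x ^ n = 1) (hx1 : x ≠ 1) :
    ∑ i : Fin n, x ^ (i : ℕ) = 0 := by
  rw [Fin.sum_univ_eq_sum_range (fun i => x ^ i)]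
  have h := geom_sum_mul x n
  rw [hx, sub_self] at h
  exact (mul_eq_zero.1 h).resolve_right (sub_ne_zero.2 hx1)

end ZeroCode

/-! ### Trace vectors and Hermitian duality -/

section Duality

variable {F K L : Type*} [Field F] [Fintype F] [Field K] [Fintype K] [Field L] [Fintype L]
  [Algebra F K] [Algebra K L] {q n : ℕ}

omit [Fintype L] in
theorem evalAt_pow_card (hK : Fintype.card K = q ^ 2) (v : Fin n → K) (x : L) :
    evalAt v (x ^ q ^ 2) = evalAt v x ^ q ^ 2 := by
  rw [evalAt, evalAt, ← hK, sum_pow_card (algebraMap K L)]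
  refine Finset.sum_congr rfl fun i _ => ?_
  rw [mul_pow, ← map_pow, FiniteField.pow_card, ← pow_mul, ← pow_mul, mul_comm (i : ℕ)]

theorem pow_sq_pow_sq (hL : Fintype.card L = q ^ 4) (x : L) : (x ^ q ^ 2) ^ q ^ 2 = x := by
  rw [← pow_mul, ← pow_add, ← hL, FiniteField.pow_card]

/-- `u` consists of the values of the trace form `z ↦ z + z ^ (q ^ 2)` at `c * y ^ i`. -/
def IsTraceVec (q : ℕ) (c y : L) (u : Fin n → K) : Prop :=
  ∀ i : Fin n, algebraMap K L (u i) = c * y ^ (i : ℕ) + (c * y ^ (i : ℕ)) ^ q ^ 2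

theorem exists_isTraceVec (hK : Fintype.card K = q ^ 2) (hL : Fintype.card L = q ^ 4) (c y : L) :
    ∃ u : Fin n → K, IsTraceVec q c y u := by
  have h : ∀ z : L, ∃ k : K, algebraMap K L k = z + z ^ q ^ 2 := fun z =>
    exists_algebraMap_eq_of_pow_card_eq (by
      rw [add_pow_card (algebraMap K L), hK, pow_sq_pow_sq hL, add_comm])
  choose f hf using h
  exact ⟨fun i => f (c * y ^ (i : ℕ)), fun i => hf _⟩

/-- Nondegeneracy of the trace pairing: c * y runs over all of L when y ≠ 0. -/
theorem eq_zero_of_forall_trace_eq_zero (hq : 3 ≤ q) (hL : Fintype.card L = q ^ 4) {y : L}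
    (hy : ∀ c : L, c * y + (c * y) ^ q ^ 2 = 0) : y = 0 := by
  obtain ⟨t, ht⟩ := exists_add_pow_ne_zero (L := L) (m := q ^ 2) (by nlinarith)
    (by rw [hL]; exact Nat.pow_lt_pow_right (by omega) (by norm_num))
  by_contra h
  have := hy (t / y)
  rw [div_mul_cancel₀ _ h] at this
  exact ht this

omit [Fintype L] in
/-- The Hermitian product of a trace vector and `v` is the trace of a power of a value of `v`. -/
theorem IsTraceVec.sum_mul_pow (hF : Fintype.card F = q) (hK : Fintype.card K = q ^ 2) {c x : L}
    {u : Fin n → K} (hu : IsTraceVec q c (x ^ q) u) (v : Fin n → K) :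
    algebraMap K L (∑ i, u i * v i ^ q) =
      c * evalAt v x ^ q + (c * evalAt v x ^ q) ^ q ^ 2 := by
  have h1 : c * evalAt v x ^ q = ∑ i : Fin n, c * (x ^ q) ^ (i : ℕ) * algebraMap K L (v i) ^ q := by
    rw [evalAt, ← hF, sum_pow_card ((algebraMap K L).comp (algebraMap F K)), Finset.mul_sum]
    refine Finset.sum_congr rfl fun i _ => ?_
    rw [mul_pow, ← pow_mul, ← pow_mul, mul_comm (i : ℕ)]
    ring
  -- Each v i ^ q lies in K, is fixed by the q²-power, and so factors out of the trace.
  rw [h1, ← hK, sum_pow_card (algebraMap K L), ← Finset.sum_add_distrib, map_sum]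
  refine Finset.sum_congr rfl fun i _ => ?_
  rw [map_mul, hu i, map_pow, mul_pow (c * (x ^ q) ^ (i : ℕ)) (_ ^ q), ← map_pow, ← map_pow,
    FiniteField.pow_card, hK]
  ring

theorem sum_mul_pow_swap (hF : Fintype.card F = q) (hK : Fintype.card K = q ^ 2)
    (u v : Fin n → K) : ∑ i, v i * u i ^ q = (∑ i, u i * v i ^ q) ^ q := by
  conv_rhs => rw [← hF, sum_pow_card (algebraMap F K), hF]
  refine Finset.sum_congr rfl fun i _ => ?_
  rw [mul_pow, ← pow_mul, ← pow_two, ← hK, FiniteField.pow_card, mul_comm]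

theorem pow_length_eq_one (hL : Fintype.card L = q ^ 4) (hn : n = q ^ 4 - 1) {x : L}
    (hx : x ≠ 0) : x ^ n = 1 := by
  rw [hn, ← hL, FiniteField.pow_card_sub_one_eq_one x hx]

-- When y is nonzero, these geometric sums vanish at nonzero x unless x is y⁻¹ or its conjugate, so
-- trace vectors yield codewords with at most these two non-zeros.
omit [Fintype K] [Fintype L] in
theorem evalAt_traceVec {c x y : L} {u : Fin n → K} (hu : IsTraceVec q c y u) :
    evalAt u x = c * ∑ i : Fin n, (y * x) ^ (i : ℕ) +
      c ^ q ^ 2 * ∑ i : Fin n, (y ^ q ^ 2 * x) ^ (i : ℕ) := by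
  rw [evalAt, Finset.mul_sum, Finset.mul_sum, ← Finset.sum_add_distrib]
  refine Finset.sum_congr rfl fun i _ => ?_
  rw [hu i, mul_pow, mul_pow, mul_pow, ← pow_mul, ← pow_mul, mul_comm (i : ℕ)]
  ring

omit [Fintype K] in
theorem IsTraceVec.mem_zeroCode (hL : Fintype.card L = q ^ 4) (hn : n = q ^ 4 - 1) {X : Set L}
    (hX0 : ∀ x ∈ X, x ≠ 0) (hXq : ∀ x ∈ X, x ^ q ^ 2 ∈ X) {c y : L} (hy0 : y ≠ 0)
    (hy : y⁻¹ ∉ X) {u : Fin n → K} (hu : IsTraceVec q c y u) : u ∈ zeroCode K n X := by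
  intro x hx
  have hx0 := hX0 x hx
  have hyx : y * x ≠ 1 := fun h => hy (by rwa [← eq_inv_of_mul_eq_one_right h])
  have hyx' : y ^ q ^ 2 * x ≠ 1 := fun h => hy (by
    have h1 := hXq x hx
    rwa [eq_inv_of_mul_eq_one_right h, inv_pow, pow_sq_pow_sq hL] at h1)
  rw [evalAt_traceVec hu,
    sum_pow_eq_zero (pow_length_eq_one hL hn (mul_ne_zero hy0 hx0)) hyx,
    sum_pow_eq_zero (pow_length_eq_one hL hn (mul_ne_zero (pow_ne_zero _ hy0) hx0)) hyx',
    mul_zero, mul_zero, add_zero]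

omit [Fintype K] in
theorem natCast_ne_zero_of_eq (hF : Fintype.card F = q) (hq : 3 ≤ q) (hn : n = q ^ 4 - 1) :
    (n : K) ≠ 0 := by
  have h1 : (q : K) = 0 := by
    rw [← hF, ← map_natCast (algebraMap F K), FiniteField.cast_card_eq_zero, map_zero]
  rw [hn, Nat.cast_sub (Nat.one_le_pow _ _ (by omega)), Nat.cast_pow, h1]
  simp

/-- Each nonzero point outside of `X` is a non-zero of some codeword. -/
theorem mem_of_forall_evalAt_eq_zero (hF : Fintype.card F = q) (hK : Fintype.card K = q ^ 2)
    (hL : Fintype.card L = q ^ 4) (hq : 3 ≤ q) (hn : n = q ^ 4 - 1) {X : Set L}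
    (hX0 : ∀ x ∈ X, x ≠ 0) (hXq : ∀ x ∈ X, x ^ q ^ 2 ∈ X) {y : L} (hy0 : y ≠ 0)
    (hy : ∀ v ∈ zeroCode K n X, evalAt v y = 0) : y ∈ X := by
  by_contra hyX
  have hnL : (n : L) ≠ 0 := by
    rw [← map_natCast (algebraMap K L)]
    exact (map_ne_zero _).2 (natCast_ne_zero_of_eq hF hq hn)
  have key : ∀ c : L, c * n + c ^ q ^ 2 * ∑ i : Fin n, ((y⁻¹) ^ q ^ 2 * y) ^ (i : ℕ) = 0 := by
    intro c
    obtain ⟨u, hu⟩ := exists_isTraceVec (n := n) hK hL c y⁻¹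
    have h := hy u (hu.mem_zeroCode hL hn hX0 hXq (inv_ne_zero hy0) (by rwa [inv_inv]))
    rw [evalAt_traceVec hu, inv_mul_cancel₀ hy0] at h
    simpa using h
  -- Here y is its own conjugate, and `key` says that n times every trace vanishes. Otherwise the
  -- second sum is 0 and c = 1 gives n = 0 in L.
  by_cases h1 : (y⁻¹) ^ q ^ 2 * y = 1
  · obtain ⟨t, ht⟩ := exists_add_pow_ne_zero (L := L) (m := q ^ 2) (by nlinarith)
      (by rw [hL]; exact Nat.pow_lt_pow_right (by omega) (by norm_num))
    have h2 := key t
    simp only [h1, one_pow, Finset.sum_const, Finset.card_univ, Fintype.card_fin, nsmul_eq_mul,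
      mul_one] at h2
    exact mul_ne_zero ht hnL (by rw [add_mul, h2])
  · have h2 := key 1
    rw [sum_pow_eq_zero (pow_length_eq_one hL hn
      (mul_ne_zero (pow_ne_zero _ (inv_ne_zero hy0)) hy0)) h1, mul_zero, add_zero, one_mul] at h2
    exact hnL h2

/-- The vectors that are Hermitian orthogonal to the Hermitian dual of a code with zeros `X` are
codewords. -/
theorem mem_zeroCode_of_forall_hermitianDual (hF : Fintype.card F = q)
    (hK : Fintype.card K = q ^ 2) (hL : Fintype.card L = q ^ 4) (hq : 3 ≤ q) {X : Set L}
    {v : Fin n → K}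
    (hv : ∀ u ∈ hermitianDual q (zeroCode K n X), ∑ i, u i * v i ^ q = 0) :
    v ∈ zeroCode K n X := by
  intro x hx
  have hq0 : q ≠ 0 := by omega
  refine (pow_eq_zero_iff hq0).1 (eq_zero_of_forall_trace_eq_zero hq hL fun c => ?_)
  -- These vectors lie in the Hermitian dual, since their product with w is the trace of c * evalAt
  -- w x ^ q. Testing v against all c forces evalAt v x = 0.
  obtain ⟨u, hu⟩ := exists_isTraceVec (n := n) hK hL c (x ^ q)
  rw [← hu.sum_mul_pow hF hK, hv u, map_zero]
  intro w hw
  refine (algebraMap K L).injective ?_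
  rw [hu.sum_mul_pow hF hK, hw x hx, zero_pow hq0, mul_zero, zero_pow (pow_ne_zero 2 hq0),
    add_zero, map_zero]

/-- Zeros of the vectors of the Hermitian dual. -/
theorem evalAt_eq_zero_of_mem_hermitianDual (hF : Fintype.card F = q)
    (hK : Fintype.card K = q ^ 2) (hL : Fintype.card L = q ^ 4) (hq : 3 ≤ q) (hn : n = q ^ 4 - 1)
    {X : Set L} (hX0 : ∀ x ∈ X, x ≠ 0) (hXq : ∀ x ∈ X, x ^ q ^ 2 ∈ X) {u : Fin n → K}
    (hu : u ∈ hermitianDual q (zeroCode K n X)) {x : L} (hx0 : x ≠ 0) (hx : (x ^ q)⁻¹ ∉ X) :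
    evalAt u x = 0 := by
  have hq0 : q ≠ 0 := by omega
  refine (pow_eq_zero_iff hq0).1 (eq_zero_of_forall_trace_eq_zero hq hL fun c => ?_)
  obtain ⟨v, hv⟩ := exists_isTraceVec (n := n) hK hL c (x ^ q)
  rw [← hv.sum_mul_pow hF hK, sum_mul_pow_swap hF hK,
    hu v (hv.mem_zeroCode hL hn hX0 hXq (pow_ne_zero _ hx0) hx), zero_pow hq0, map_zero]

end Duality

/-! ### The symplectic form and the Hermitian form -/

section Coordinates

variable {F K : Type*} [Field F] [Fintype F] [Field K] [Fintype K] [Algebra F K] {q n : ℕ}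

/-- The identification of `K ^ n` with `F ^ n × F ^ n`. -/
noncomputable def coordEquiv (β : Module.Basis (Fin 2) F K) (n : ℕ) :
    (Fin n → K) ≃ₗ[F] (Fin n → F) × (Fin n → F) where
  toFun u := (fun i => β.repr (u i) 0, fun i => β.repr (u i) 1)
  invFun p := fun i => p.1 i • β 0 + p.2 i • β 1
  map_add' u v := by ext <;> simp
  map_smul' c u := by ext <;> simp
  left_inv u := by
    funext i
    conv_rhs => rw [← β.sum_repr (u i)]
    rw [Fin.sum_univ_two]
  right_inv p := by
    ext i <;> simp

omit [Fintype K] in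
/-- The difference of the Hermitian products is a multiple of the symplectic form. -/
theorem sum_mul_pow_sub (hF : Fintype.card F = q) (β : Module.Basis (Fin 2) F K)
    (u v : Fin n → K) : ∑ i, u i * v i ^ q - ∑ i, v i * u i ^ q =
      algebraMap F K (symplecticForm F n (coordEquiv β n u) (coordEquiv β n v)) *
        (β 0 * β 1 ^ q - β 1 * β 0 ^ q) := by
  have hrepr : ∀ x : K, x = algebraMap F K (β.repr x 0) * β 0 +
      algebraMap F K (β.repr x 1) * β 1 := by
    intro x
    conv_lhs => rw [← β.sum_repr x, Fin.sum_univ_two, Algebra.smul_def, Algebra.smul_def]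
  have hF' : ∀ c : F, algebraMap F K c ^ q = algebraMap F K c := fun c => by
    rw [← map_pow, ← hF, FiniteField.pow_card]
  have hpow : ∀ x : K, x ^ q = algebraMap F K (β.repr x 0) * β 0 ^ q +
      algebraMap F K (β.repr x 1) * β 1 ^ q := by
    intro x
    conv_lhs => rw [hrepr x, ← hF, add_pow_card (algebraMap F K), hF, mul_pow, mul_pow, hF', hF']
  rw [symplecticForm_apply, dotProduct, dotProduct, ← Finset.sum_sub_distrib,
    ← Finset.sum_sub_distrib, map_sum, Finset.sum_mul]
  refine Finset.sum_congr rfl fun i _ => ?_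
  rw [hpow (u i), hpow (v i)]
  simp only [coordEquiv, LinearEquiv.coe_mk, LinearMap.coe_mk, AddHom.coe_mk, map_sub, map_mul]
  linear_combination (algebraMap F K (β.repr (v i) 0) * β 0 ^ q +
      algebraMap F K (β.repr (v i) 1) * β 1 ^ q) * hrepr (u i) -
    (algebraMap F K (β.repr (u i) 0) * β 0 ^ q +
      algebraMap F K (β.repr (u i) 1) * β 1 ^ q) * hrepr (v i)

theorem mul_pow_sub_mul_pow_ne_zero (hF : Fintype.card F = q) (hK : Fintype.card K = q ^ 2)
    (β : Module.Basis (Fin 2) F K) : β 0 * β 1 ^ q - β 1 * β 0 ^ q ≠ 0 := by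
  intro h
  have hq1 : 1 < q := by rw [← hF]; exact Fintype.one_lt_card
  obtain ⟨x, hx⟩ := exists_pow_ne_self (L := K) hq1 (by rw [hK]; nlinarith)
  have h1 := sum_mul_pow_sub (n := 1) hF β (fun _ => x) (fun _ => 1)
  rw [h, mul_zero] at h1
  simp only [Finset.univ_unique, Finset.sum_const, Finset.card_singleton, one_smul, one_pow,
    mul_one, one_mul] at h1
  exact hx (sub_eq_zero.1 h1).symm

/-- By `sum_mul_pow_swap`, the right side says that the Hermitian product is fixed by the q-power.
This is weaker than its vanishing. -/
theorem symplecticForm_coordEquiv_eq_zero_iff (hF : Fintype.card F = q)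
    (hK : Fintype.card K = q ^ 2) (β : Module.Basis (Fin 2) F K) (u v : Fin n → K) :
    symplecticForm F n (coordEquiv β n u) (coordEquiv β n v) = 0 ↔
      ∑ i, u i * v i ^ q = ∑ i, v i * u i ^ q := by
  rw [← sub_eq_zero (a := ∑ i, u i * v i ^ q), sum_mul_pow_sub hF β, mul_eq_zero,
    or_iff_left (mul_pow_sub_mul_pow_ne_zero hF hK β), map_eq_zero (algebraMap F K)]

end Coordinates

/-! ### The Hermitian construction from a code with prescribed zeros -/

section HermitianCode

variable {F K L : Type*} [Field F] [Fintype F] [Field K] [Fintype K] [Field L] [Fintype L]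
  [Algebra F K] [Algebra K L] {q n : ℕ}

/-- A subspace of `K ^ n` in symplectic coordinates. -/
noncomputable def coordSubmodule (β : Module.Basis (Fin 2) F K) (C : Submodule K (Fin n → K)) :
    Submodule F ((Fin n → F) × (Fin n → F)) :=
  (C.restrictScalars F).map (coordEquiv β n : (Fin n → K) →ₗ[F] (Fin n → F) × (Fin n → F))

omit [Fintype F] [Fintype K] in
theorem coordEquiv_mem_coordSubmodule (β : Module.Basis (Fin 2) F K)
    {C : Submodule K (Fin n → K)} {u : Fin n → K} :
    coordEquiv β n u ∈ coordSubmodule β C ↔ u ∈ C := by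
  constructor
  · rintro ⟨v, hv, h⟩
    rwa [← (coordEquiv β n).injective h]
  · exact fun h => ⟨u, h, rfl⟩

omit [Fintype F] [Fintype K] in
theorem finrank_coordSubmodule (β : Module.Basis (Fin 2) F K) (C : Submodule K (Fin n → K)) :
    Module.finrank F (coordSubmodule β C) = 2 * Module.finrank K C := by
  have h1 : Module.finrank F (coordSubmodule β C) = Module.finrank F (C.restrictScalars F) :=
    LinearEquiv.finrank_map_eq (coordEquiv β n) _
  have h2 : Module.finrank F K = 2 := by
    rw [Module.finrank_eq_card_basis β, Fintype.card_fin]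
  have h3 := Module.finrank_mul_finrank F K C
  rw [h2] at h3
  rw [h1, h3]
  rfl

/-- In symplectic coordinates, the orthogonal complement of the Hermitian dual is the code. -/
theorem orthogonal_coordSubmodule_hermitianDual (hF : Fintype.card F = q)
    (hK : Fintype.card K = q ^ 2) (hL : Fintype.card L = q ^ 4) (hq : 3 ≤ q)
    (β : Module.Basis (Fin 2) F K) (X : Set L) :
    (symplecticForm F n).orthogonal (coordSubmodule β (hermitianDual q (zeroCode K n X))) =
      coordSubmodule β (zeroCode K n X) := by
  ext w
  obtain ⟨v, rfl⟩ := (coordEquiv β n).surjective w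
  rw [coordEquiv_mem_coordSubmodule]
  constructor
  · intro hv
    refine mem_zeroCode_of_forall_hermitianDual hF hK hL hq fun u hu => ?_
    -- The dual is K-linear, so every K-multiple of the product is fixed by the q-power, which is
    -- impossible for a nonzero product.
    have hfix : ∀ c : K, c * ∑ i, u i * v i ^ q = (c * ∑ i, u i * v i ^ q) ^ q := by
      intro c
      have h : symplecticForm F n (coordEquiv β n (c • u)) (coordEquiv β n v) = 0 :=
        hv _ ((coordEquiv_mem_coordSubmodule β).2 (Submodule.smul_mem _ c hu))
      rw [symplecticForm_coordEquiv_eq_zero_iff hF hK, sum_mul_pow_swap hF hK (c • u) v] at h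
      simpa [Finset.mul_sum, mul_assoc] using h
    obtain ⟨c, hc⟩ := exists_pow_ne_self (L := K) (m := q) (by omega) (by rw [hK]; nlinarith)
    by_contra hne
    have h1 := hfix 1
    have h2 := hfix c
    rw [one_mul] at h1
    rw [mul_pow, ← h1] at h2
    exact hc (mul_right_cancel₀ hne h2).symm
  · rintro hv _ ⟨u, hu, rfl⟩
    have h : ∑ i, u i * v i ^ q = 0 := hu v hv
    refine (symplecticForm_coordEquiv_eq_zero_iff hF hK β u v).2 ?_
    rw [sum_mul_pow_swap hF hK u v, h, zero_pow (by omega)]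

variable [DecidableEq F]

/-- The Hermitian construction from a code with zeros `X ∋ 1` such that `1` is the only point of
`X` whose power with exponent `-q` lies in `X`. -/
theorem exists_hermitianConstruction (hF : Fintype.card F = q) (hK : Fintype.card K = q ^ 2)
    (hL : Fintype.card L = q ^ 4) (hq : 3 ≤ q) (hn : n = q ^ 4 - 1)
    (β : Module.Basis (Fin 2) F K) {χ : AddChar F ℂ} (hχ : χ ≠ 1) {X : Set L}
    (hX0 : ∀ x ∈ X, x ≠ 0) (hXq : ∀ x ∈ X, x ^ q ^ 2 ∈ X) (hX1 : (1 : L) ∈ X)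
    (hXneg : ∀ x ∈ X, x ≠ 1 → (x ^ q)⁻¹ ∉ X) {k r : ℕ}
    (hr : n ≤ Module.finrank K (zeroCode K n X) + r) (hk : k + 2 * r ≤ n + 1) {d : ℕ}
    (hd : ∀ v ∈ zeroCode K n X, ∀ T : Finset (Fin n), T.card < d → (∀ i ∉ T, v i = 0) → v = 0) :
    ∃ Q : Code F n k 1, Q.MinDistGE d ∧ IsHermitianConstruction β χ (zeroCode K n X) Q := by
  set C := zeroCode K n X with hC
  set D := coordSubmodule β (hermitianDual q C) with hD
  have horth : (symplecticForm F n).orthogonal D = coordSubmodule β C :=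
    orthogonal_coordSubmodule_hermitianDual hF hK hL hq β X
  have hdim : Module.finrank F D ≤ 2 * r := by
    have h1 := LinearMap.BilinForm.finrank_orthogonal
      (symplecticForm_nondegenerate (F := F) (n := n)) D
    rw [horth, finrank_coordSubmodule, Module.finrank_prod, Module.finrank_fin_fun] at h1
    have h2 := Submodule.finrank_le D
    rw [Module.finrank_prod, Module.finrank_fin_fun] at h2
    omega
  obtain ⟨κ, hκ⟩ := exists_pow_ne_self (L := K) (m := q) (by omega) (by rw [hK]; nlinarith)
  have hsum : ∀ u : Fin n → K, evalAt u (1 : L) = algebraMap K L (∑ i, u i) := by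
    intro u
    simp [evalAt]
  have hpow : ∀ u : Fin n → K, ∑ i, u i ^ q = (∑ i, u i) ^ q := by
    intro u
    rw [← hF, sum_pow_card (algebraMap F K)]
  have hconst : ∀ c : K, (fun _ => c) ∈ hermitianDual q C := by
    intro c v hv
    have h1 : ∑ i, v i = 0 := by
      rw [← map_eq_zero (algebraMap K L), ← hsum, hv 1 hX1]
    rw [← Finset.mul_sum, hpow, h1, zero_pow (by omega), mul_zero]
  -- The constants κ and 1 are a hyperbolic pair: their Hermitian product nκ is not fixed by the
  -- q-power, as n ≠ 0 in K.
  obtain ⟨Q, hQ⟩ := exists_code_of_hyperbolic_pair (k := k) hχ D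
    (h₁ := coordEquiv β n fun _ => κ) (h₂ := coordEquiv β n fun _ => 1)
    ((coordEquiv_mem_coordSubmodule β).2 (hconst κ))
    ((coordEquiv_mem_coordSubmodule β).2 (hconst 1)) (by
      rw [Ne, symplecticForm_coordEquiv_eq_zero_iff hF hK]
      simp only [one_pow, mul_one, one_mul, Finset.sum_const, Finset.card_univ, Fintype.card_fin,
        nsmul_eq_mul]
      exact fun h => hκ (mul_left_cancel₀ (natCast_ne_zero_of_eq hF hq hn) h).symm)
    (by
      rintro _ ⟨u, hu, rfl⟩ h1 h2
      have h1 := (symplecticForm_coordEquiv_eq_zero_iff hF hK β _ u).1 h1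
      have h2 := (symplecticForm_coordEquiv_eq_zero_iff hF hK β _ u).1 h2
      rw [← Finset.mul_sum, ← Finset.sum_mul, hpow] at h1 h2
      rw [one_mul, one_pow, mul_one] at h2
      -- With S the coordinate sum, `h2` gives S^q = S and `h1` then gives κS = κ^q S. So u vanishes
      -- at 1; at the other zeros `hXneg` applies.
      have hS : ∑ i, u i = 0 := by
        rw [h2, mul_comm κ] at h1
        by_contra hne
        exact hκ (mul_left_cancel₀ hne h1).symm
      rw [horth]
      refine (coordEquiv_mem_coordSubmodule β).2 fun x hx => ?_
      by_cases hx1 : x = 1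
      · rw [hx1, hsum, hS, map_zero]
      · exact evalAt_eq_zero_of_mem_hermitianDual hF hK hL hq hn hX0 hXq hu (hX0 x hx)
          (hXneg x hx hx1))
    (by omega)
  refine ⟨Q, Q.minDistGE_of_stabilizer hχ d D hQ fun T hT e he0 heT => ?_, fun u hu => ?_⟩
  · by_contra! hcon
    have he : e ∈ coordSubmodule β C := horth ▸ fun u hu => hcon u hu
    obtain ⟨v, hv, rfl⟩ := he
    refine he0 ((hd v hv T hT fun i hi => ?_) ▸ map_zero _)
    refine β.ext_elem fun j => ?_
    rw [map_zero]
    fin_cases j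
    · exact (heT i hi).1
    · exact (heT i hi).2
  · rw [hF] at hu
    obtain ⟨B, hB, h⟩ := hQ (coordEquiv β n u) ((coordEquiv_mem_coordSubmodule β).2 hu)
    exact ⟨B, hB, h⟩

end HermitianCode

/-! ### The zeros of the code -/

section Zeros

variable {K L : Type*} [Field K] [Fintype K] [Field L] [Fintype L] [Algebra K L] {q a n : ℕ}

/-- The roots of unity with exponents in the cyclotomic cosets of `0` and of `q ^ 2 + i` for
`1 ≤ i ≤ a`. -/
def zeroSet (q a : ℕ) (α : L) : Set L :=
  {x | x = 1 ∨ ∃ i, 1 ≤ i ∧ i ≤ a ∧ (x = α ^ (q ^ 2 + i) ∨ x = (α ^ (q ^ 2 + i)) ^ q ^ 2)}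

/-- The q²-power is an involution of L, so a coset has at most two elements. -/
theorem mem_cyclotomicCoset_iff (hL : Fintype.card L = q ^ 4) {α : L} (hα : IsPrimitiveRoot α n)
    {z s : ℕ} (hz : z < n) :
    z ∈ cyclotomicCoset (q ^ 2) n s ↔ α ^ z = α ^ s ∨ α ^ z = (α ^ s) ^ q ^ 2 := by
  have hmod : ∀ m : ℕ, α ^ (m % n) = α ^ m := fun m => by
    rw [hα.eq_orderOf, pow_mod_orderOf]
  have hiff : ∀ m : ℕ, z = m % n ↔ α ^ z = α ^ m := fun m => by
    rw [← hmod m]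
    exact ⟨fun h => by rw [← h], fun h => hα.pow_inj hz (Nat.mod_lt _ (by omega)) h⟩
  constructor
  · rintro ⟨j, hj⟩
    rw [hiff, pow_mul] at hj
    rw [hj]
    clear hj
    induction j with
    | zero => left; simp
    | succ j ih =>
      rw [pow_succ, pow_mul]
      rcases ih with h | h
      · right; rw [h]
      · left; rw [h, pow_sq_pow_sq hL]
  · rintro (h | h)
    · exact ⟨0, by rw [hiff, h]; simp⟩
    · exact ⟨1, by rw [hiff, h, pow_one, pow_mul]⟩

theorem pow_mem_zeroSet (hL : Fintype.card L = q ^ 4) {α : L} :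
    ∀ x ∈ zeroSet q a α, x ^ q ^ 2 ∈ zeroSet q a α := by
  rintro x (rfl | ⟨i, h1, h2, rfl | rfl⟩)
  · left; exact one_pow _
  · exact Or.inr ⟨i, h1, h2, Or.inr rfl⟩
  · exact Or.inr ⟨i, h1, h2, Or.inl (pow_sq_pow_sq hL _)⟩

omit [Fintype L] in
theorem ne_zero_of_mem_zeroSet {α : L} (hα : α ≠ 0) : ∀ x ∈ zeroSet q a α, x ≠ 0 := by
  rintro x (rfl | ⟨i, h1, h2, rfl | rfl⟩)
  · exact one_ne_zero
  · exact pow_ne_zero _ hα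
  · exact pow_ne_zero _ (pow_ne_zero _ hα)

-- In exponents, n would divide (q²+i)q + m. For m = 0 or m = q²+i' this sum is positive and below
-- n. For the conjugate, m may be taken as 1 + i'q²; the sum is then below 2n, so it equals q⁴ - 1,
-- and reduction modulo q gives q ∣ 2.
omit [Fintype L] in
theorem pow_inv_notMem_zeroSet_of_le (hq : 3 ≤ q) (ha : a ≤ q ^ 2 - 1) (hn : n = q ^ 4 - 1) {α : L}
    (hα : IsPrimitiveRoot α n) {i : ℕ} (h2 : i ≤ a) :
    ((α ^ (q ^ 2 + i)) ^ q)⁻¹ ∉ zeroSet q a α := by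
  have hq4 : q ^ 4 = n + 1 := by have := Nat.one_le_pow 4 q (by omega); omega
  have hα0 : α ≠ 0 := hα.ne_zero (by
    have := Nat.one_lt_pow (n := 4) (by norm_num) (show 1 < q by omega)
    omega)
  have hαn : α ^ q ^ 4 = α := by rw [hq4, pow_succ, hα.pow_eq_one, one_mul]
  have hdvd : ∀ m : ℕ, ((α ^ (q ^ 2 + i)) ^ q)⁻¹ = α ^ m → n ∣ (q ^ 2 + i) * q + m := by
    intro m hm
    rw [← hα.pow_eq_one_iff_dvd, pow_add, pow_mul, ← hm]
    exact mul_inv_cancel₀ (pow_ne_zero _ (pow_ne_zero _ hα0))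
  have ha1 : a + 1 ≤ q ^ 2 := by have := Nat.one_le_pow 2 q (by omega); omega
  have h3 : i * q + q ≤ q ^ 2 * q := by nlinarith
  have h4 : 9 ≤ q ^ 2 := by nlinarith
  have h5 : 3 * (q ^ 2 * q) ≤ q ^ 4 := by
    have : q ^ 4 = q * (q ^ 2 * q) := by ring
    rw [this]; exact Nat.mul_le_mul_right _ hq
  have h6 : 3 * q ^ 2 ≤ q ^ 2 * q := by nlinarith
  rintro (h | ⟨i', h1', h2', h | h⟩)
  · have := Nat.le_of_dvd (by nlinarith) (hdvd 0 (by rw [h, pow_zero]))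
    rw [add_mul] at this
    omega
  · have := Nat.le_of_dvd (by nlinarith) (hdvd _ h)
    rw [add_mul] at this
    omega
  · have h7 : (α ^ (q ^ 2 + i')) ^ q ^ 2 = α ^ (1 + i' * q ^ 2) := by
      rw [← pow_mul, add_mul, ← pow_add, pow_add, hαn, pow_add, pow_one]
    rw [h7] at h
    obtain ⟨t, ht⟩ := hdvd _ h
    have h8 : (i' + 1) * q ^ 2 ≤ q ^ 4 := by
      have : q ^ 4 = q ^ 2 * q ^ 2 := by ring
      rw [this]; exact Nat.mul_le_mul_right _ (by omega)
    rw [add_mul] at h8 ht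
    have ht1 : t = 1 := by
      have ht2 : t < 2 := by
        by_contra hcon
        have : n * 2 ≤ n * t := Nat.mul_le_mul_left _ (by omega)
        omega
      have ht0 : t ≠ 0 := by rintro rfl; omega
      omega
    rw [ht1, mul_one] at ht
    have h9 : q ∣ 2 := by
      have e1 : q ^ 4 = q ^ 2 * q + i * q + i' * q ^ 2 + 2 := by omega
      have d1 : q ∣ q ^ 4 := dvd_pow_self q (by norm_num)
      have d2 : q ∣ q ^ 2 * q + i * q + i' * q ^ 2 :=
        dvd_add (dvd_add (dvd_mul_left _ _) (dvd_mul_left _ _))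
          (Dvd.dvd.mul_left (dvd_pow_self q (by norm_num)) _)
      rw [e1] at d1
      exact (Nat.dvd_add_right d2).1 d1
    exact absurd (Nat.le_of_dvd (by norm_num) h9) (by omega)

theorem pow_inv_notMem_zeroSet (hL : Fintype.card L = q ^ 4) (hq : 3 ≤ q) (ha : a ≤ q ^ 2 - 1)
    (hn : n = q ^ 4 - 1) {α : L} (hα : IsPrimitiveRoot α n) :
    ∀ x ∈ zeroSet q a α, x ≠ 1 → (x ^ q)⁻¹ ∉ zeroSet q a α := by
  rintro x (rfl | ⟨i, h1, h2, rfl | rfl⟩) hx1 hx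
  · exact hx1 rfl
  · exact pow_inv_notMem_zeroSet_of_le hq ha hn hα h2 hx
  · refine pow_inv_notMem_zeroSet_of_le hq ha hn hα h2 ?_
    have h := pow_mem_zeroSet hL _ hx
    rwa [inv_pow, pow_right_comm, pow_sq_pow_sq hL] at h

/-- The code with zeros `zeroSet q a α` has codimension at most `2 * a`. -/
theorem le_finrank_zeroCode (hK : Fintype.card K = q ^ 2) (hL : Fintype.card L = q ^ 4)
    (hq : 3 ≤ q) (ha : 1 ≤ a) {α : L} :
    n ≤ Module.finrank K (zeroCode K n (zeroSet q a α)) + 2 * a := by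
  -- α^(q²+1) is a norm and lies in K, so this zero costs one K-linear condition instead of two.
  obtain ⟨κ, hκ⟩ : ∃ κ : K, algebraMap K L κ = α ^ (q ^ 2 + 1) :=
    exists_algebraMap_eq_of_pow_card_eq (by
      rw [hK, pow_add, mul_pow, pow_sq_pow_sq hL, pow_one, mul_comm])
  have hKL : Module.finrank K L = 2 := by
    have h := Module.card_eq_pow_finrank (K := K) (V := L)
    rw [hL, hK, ← pow_mul] at h
    have := Nat.pow_right_injective (by omega : 2 ≤ q) h
    omega
  -- The target has dimension 1 + 1 + 2(a - 1) = 2a; conjugate zeros follow from `evalAt_pow_card`.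
  let f : (Fin n → K) →ₗ[K] K × K × (Fin (a - 1) → L) :=
    { toFun := fun v => (∑ i, v i, ∑ i, v i * κ ^ (i : ℕ),
        fun j => evalAt v (α ^ (q ^ 2 + (j + 2))))
      map_add' := fun u v => by
        simp only [evalAt, Pi.add_apply, add_mul, map_add, Finset.sum_add_distrib]; rfl
      map_smul' := fun c v => by
        ext <;> simp [evalAt, Finset.mul_sum, mul_assoc, Algebra.smul_def] }
  have hker : LinearMap.ker f ≤ zeroCode K n (zeroSet q a α) := by
    intro v hv
    have hv : f v = 0 := hv
    have hv0 : ∑ i, v i = 0 := congrArg Prod.fst hv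
    have hv1 : ∑ i, v i * κ ^ (i : ℕ) = 0 := congrArg (fun p => p.2.1) hv
    have hv2 : ∀ j : Fin (a - 1), evalAt v (α ^ (q ^ 2 + (j + 2))) = 0 := fun j =>
      congrFun (congrArg (fun p => p.2.2) hv) j
    have hv3 : ∀ i, 1 ≤ i → i ≤ a → evalAt v (α ^ (q ^ 2 + i)) = 0 := by
      intro i h1 h2
      by_cases hi : i = 1
      · subst hi
        rw [← hκ, ← map_zero (algebraMap K L), ← hv1, map_sum]
        exact Finset.sum_congr rfl fun i _ => by rw [map_mul, map_pow]
      · have h := hv2 ⟨i - 2, by omega⟩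
        simpa only [Nat.sub_add_cancel (show 2 ≤ i by omega)] using h
    rintro x (rfl | ⟨i, h1, h2, rfl | rfl⟩)
    · rw [← map_zero (algebraMap K L), ← hv0, map_sum]
      simp [evalAt]
    · exact hv3 i h1 h2
    · rw [evalAt_pow_card hK, hv3 i h1 h2, zero_pow (pow_ne_zero 2 (by omega))]
  have h1 := LinearMap.finrank_range_add_finrank_ker f
  have h2 := Submodule.finrank_mono hker
  have h3 := Submodule.finrank_le (LinearMap.range f)
  rw [Module.finrank_prod, Module.finrank_prod, Module.finrank_self, Module.finrank_pi_fintype,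
    Finset.sum_const, hKL, Finset.card_univ, Fintype.card_fin, smul_eq_mul] at h3
  rw [Module.finrank_fin_fun] at h1
  omega

end Zeros

end QUENTA

theorem mainTheorem7
    (q a n : ℕ) (hq : 3 ≤ q) (ha : 2 ≤ a) (ha' : a ≤ q ^ 2 - 1) (hn : n = q ^ 4 - 1)
    {F K L : Type*} [Field F] [Fintype F] [DecidableEq F] [Field K] [Fintype K]
    [Field L] [Fintype L] [Algebra F K] [Algebra K L]
    (hF : Fintype.card F = q) (hK : Fintype.card K = q ^ 2) (hL : Fintype.card L = q ^ 4)
    (α : L) (hα : IsPrimitiveRoot α n)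
    (β : Module.Basis (Fin 2) F K) (χ : AddChar F ℂ) (hχ : χ ≠ 1) :
    ∃ C : Submodule K (Fin n → K),
      QUENTA.IsCyclicCode C ∧
      QUENTA.definingSet α C =
        QUENTA.cyclotomicCoset (q ^ 2) n 0 ∪ QUENTA.cyclotomicCoset (q ^ 2) n (q ^ 2 + 1) ∪
          (⋃ i ∈ Set.Icc 2 a, QUENTA.cyclotomicCoset (q ^ 2) n (q ^ 2 + i)) ∧
      ∃ Q : QUENTA.Code F n (n - 4 * (a - 1) - 3) 1,
        Q.MinDistGE (a + 1) ∧ QUENTA.IsHermitianConstruction β χ C Q := by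
  open QUENTA in
  have h9 : 9 ≤ q ^ 2 := by nlinarith
  -- With a < q² this keeps the subtraction n - 4(a - 1) - 3 from truncating.
  have hq4 : 9 * q ^ 2 ≤ n + 1 := by
    have h1 : q ^ 4 = q ^ 2 * q ^ 2 := by ring
    have h2 := Nat.mul_le_mul_right (q ^ 2) h9
    omega
  have hα0 : α ≠ 0 := hα.ne_zero (by omega)
  have hX0 := ne_zero_of_mem_zeroSet (q := q) (a := a) hα0
  have hXq := pow_mem_zeroSet (a := a) hL (α := α)
  refine ⟨zeroCode K n (zeroSet q a α),
    isCyclicCode_zeroCode fun x hx => pow_length_eq_one hL hn (hX0 x hx), ?_, ?_⟩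
  · have hdef : ∀ z, z ∈ definingSet α (zeroCode K n (zeroSet q a α)) ↔
        z < n ∧ α ^ z ∈ zeroSet q a α := fun z =>
      and_congr_right fun _ => ⟨fun h => mem_of_forall_evalAt_eq_zero hF hK hL hq hn hX0 hXq
        (pow_ne_zero _ hα0) h, fun h v hv => hv _ h⟩
    have hlt : ∀ z s, z ∈ cyclotomicCoset (q ^ 2) n s → z < n := by
      rintro z s ⟨j, rfl⟩
      exact Nat.mod_lt _ (by omega)
    ext z
    rw [hdef]
    simp only [Set.mem_union, Set.mem_iUnion, Set.mem_Icc, exists_prop]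
    constructor
    · rintro ⟨hz, h | ⟨i, h1, h2, h⟩⟩
      · exact Or.inl (Or.inl ((mem_cyclotomicCoset_iff hL hα hz).2 (Or.inl (by rw [h, pow_zero]))))
      · by_cases hi : i = 1
        · subst hi
          exact Or.inl (Or.inr ((mem_cyclotomicCoset_iff hL hα hz).2 h))
        · exact Or.inr ⟨i, ⟨by omega, h2⟩, (mem_cyclotomicCoset_iff hL hα hz).2 h⟩
    · rintro ((h | h) | ⟨i, hi, h⟩)
      · refine ⟨hlt _ _ h, Or.inl ?_⟩
        simpa using (mem_cyclotomicCoset_iff hL hα (hlt _ _ h)).1 h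
      · exact ⟨hlt _ _ h, Or.inr ⟨1, le_rfl, by omega,
          (mem_cyclotomicCoset_iff hL hα (hlt _ _ h)).1 h⟩⟩
      · exact ⟨hlt _ _ h, Or.inr ⟨i, by omega, hi.2,
          (mem_cyclotomicCoset_iff hL hα (hlt _ _ h)).1 h⟩⟩
  · refine exists_hermitianConstruction hF hK hL hq hn β hχ hX0 hXq (Or.inl rfl)
      (pow_inv_notMem_zeroSet hL hq ha' hn hα) (le_finrank_zeroCode hK hL hq (by omega))
      (by omega) fun v hv T hT hvT => ?_
    -- The zeros with exponents q²+1, …, q²+a are a consecutive ones, so the bound reaches weight a.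
    refine eq_zero_of_evalAt_eq_zero hα (b := q ^ 2 + 1) (d := a) (fun j hj => ?_)
      (Nat.lt_succ_iff.1 hT) hvT
    exact hv _ (Or.inr ⟨1 + j, by omega, by omega, Or.inl (by rw [add_assoc])⟩)
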